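/- **Conventions.** Let $(X,\{R_i\}_{i=0}^D)$ be a symmetric association scheme on a finite set $X$: the $R_i$ are non-empty symmetric relations that partition $X\times X$, $R_0$ is the diagonal, and for $(x,y)\in R_k$ the number $p_{ij}^k=|\{w:(x,w)\in R_i,(w,y)\in R_j\}|$ depends only on $i,j,k$. Let $A_i$ be the adjacency matrix of $R_i$, and let $E_0=|X|^{-1}J,E_1,\dots,E_D$ be an ordering of the primitive idempotents of $\mathrm{span}(A_0,\dots,A_D)$. The second eigenmatrix $Q=(Q_{ij})$ and the Krein numbers $q_{ij}^k$ are defined by $|X|E_j=\sum_i Q_{ij}A_i$ and $E_i\circ E_j=|X|^{-1}\sum_k q_{ij}^kE_k$, where $\circ$ is the entrywise product. Put $B_i=(p_{ij}^k)_{j,k}$, $B_i^*=(q_{ij}^k)_{j,k}$ (row $j$, column $k$), $a_i^*=q_{1,i}^i$, $b_i^*=q_{1,i+1}^i$ for $0\le i<D$, and $c_i^*=q_{1,i-1}^i$ for $1\le i\le D$. With respect to the ordering, the scheme is *$Q$-polynomial* if for each $i$ there is a real polynomial $v_i^*$ of degree $i$ with $Q_{li}=v_i^*(Q_{l1})$ for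 all $l$; *$Q$-bipartite* if $a_i^*=0$ for all $i$; *$Q$-antipodal* if $b_i^*=c_{D-i}^*$ for all $0\le i<D$ with $i\ne\lfloor D/2\rfloor$. The *$Q$-antipodal classes* are the classes of the equivalence relation "the rows of $E_D$ at $x$ and $y$ coincide". For $z\in X$ put $R_j(z)=\{y\in X:(z,y)\in R_j\}$. **Lemma 4.1.** Let $(X,\{R_i\}_{i=0}^4)$ be a symmetric association scheme that is $Q$-polynomial, $Q$-antipodal and $Q$-bipartite with respect to an ordering $E_0,\dots,E_4$ of its primitive idempotents, with its relations numbered so that $Q_{01}>Q_{11}>Q_{21}>Q_{31}>Q_{41}$, and with exactly $f$ $Q$-antipodal classes, each of size $2d$. Assume $f\ge 3$. Then for every $z\in X$ and $j\in\{1,3\}$, $\bigl(R_j(z),\{R_i\cap(R_j(z)\times R_j(z))\}_{i=0}^3\bigr)$ is a symmetric association scheme with $3$ classes, and its primitive idempotents can be ordered so that it is $Q$-polynomial and $Q$-antipodal with exactly $f-1$ $Q$-antipodal classes, each of size $d$, and so that $$a_1^*=\frac{d}{f-1}-2.$$ Moreover its intersection matrices are $$B_1=\begin{pmatrix}0&1&0&0\\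 \frac{(f-2)(d+\sqrt d)}{2}&\frac{(f-3)(d+3\sqrt d)}{4}&\frac{(f-2)(d+2\sqrt d)}{4}&\frac{(f-3)(d+\sqrt d)}{4}\\ 0&\frac{d+\sqrt d-2}{2}&0&\frac{d+\sqrt d}{2}\\ 0&\frac{(f-3)(d-\sqrt d)}{4}&\frac{(f-2)d}{4}&\frac{(f-3)(d+\sqrt d)}{4}\end{pmatrix},$$ $$B_2=\begin{pmatrix}0&0&1&0\\ 0&\frac{d+\sqrt d-2}{2}&0&\frac{d+\sqrt d}{2}\\ d-1&0&d-2&0\\ 0&\frac{d-\sqrt d}{2}&0&\frac{d-\sqrt d-2}{2}\end{pmatrix},$$ $$B_3=\begin{pmatrix}0&0&0&1\\ 0&\frac{(f-3)(d-\sqrt d)}{4}&\frac{(f-2)d}{4}&\frac{(f-3)(d+\sqrt d)}{4}\\ 0&\frac{d-\sqrt d}{2}&0&\frac{d-\sqrt d-2}{2}\\ \frac{(f-2)(d-\sqrt d)}{2}&\frac{(f-3)(d-\sqrt d)}{4}&\frac{(f-2)(d-2\sqrt d)}{4}&\frac{(f-3)(d-3\sqrt d)}{4}\end{pmatrix},$$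 and, for the same ordering of the idempotents, its second eigenmatrix and its first Krein matrix are $$Q=\begin{pmatrix}1&d-1&(f-2)(d-1)&f-2\\ 1&\sqrt d-1&-\sqrt d+1&-1\\ 1&-1&-f+2&f-2\\ 1&-\sqrt d-1&\sqrt d+1&-1\end{pmatrix},\qquad B_1^*=\begin{pmatrix}0&1&0&0\\ d-1&\frac{d}{f-1}-2&\frac{d}{f-1}&0\\ 0&\frac{(f-2)d}{f-1}&\frac{(f-2)d}{f-1}-2&d-1\\ 0&0&1&0\end{pmatrix}.$$ -/

import Mathlib

/-- A symmetric association scheme with `D` classes on `X`: relations `R 0, …, R D` partitioning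
`X × X`, all non-empty, with `R 0` the diagonal and every `R i` symmetric, and with
intersection numbers `p i j k` (that is, $p_{ij}^k$). -/
structure AssocScheme (X : Type*) (D : ℕ) where
  R : Fin (D + 1) → X → X → Prop
  diag : ∀ x y, R 0 x y ↔ x = y
  partition : ∀ x y, ∃! i, R i x y
  nonempty : ∀ i, ∃ x y, R i x y
  symm : ∀ i x y, R i x y → R i y x
  p : Fin (D + 1) → Fin (D + 1) → Fin (D + 1) → ℕ
  regular : ∀ i j k x y, R k x y → {w | R i x w ∧ R j w y}.ncard = p i j k

namespace AssocScheme

variable {X : Type*} {D : ℕ}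

open Classical in
/-- The adjacency matrix of the relation `R i`. -/
noncomputable def A (S : AssocScheme X D) (i : Fin (D + 1)) : Matrix X X ℝ :=
  Matrix.of fun x y => if S.R i x y then 1 else 0

/-- The Bose–Mesner algebra, as a space of matrices: the linear span of the adjacency matrices. -/
noncomputable def boseMesner (S : AssocScheme X D) : Submodule ℝ (Matrix X X ℝ) :=
  Submodule.span ℝ (Set.range S.A)

/-- The intersection matrix `B i`, with `(j, k)` entry $p_{ij}^k$. -/
def intersectionMatrix (S : AssocScheme X D) (i : Fin (D + 1)) :
    Matrix (Fin (D + 1)) (Fin (D + 1)) ℝ :=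
  Matrix.of fun j k => (S.p i j k : ℝ)

/-- The subconstituent `R_j(z)`, as a type. -/
def Subconstituent (S : AssocScheme X D) (j : Fin (D + 1)) (z : X) : Type _ :=
  {y : X // S.R j z y}

noncomputable instance [Fintype X] (S : AssocScheme X D) (j : Fin (D + 1)) (z : X) :
    Fintype (S.Subconstituent j z) :=
  haveI : Finite (S.Subconstituent j z) := inferInstanceAs (Finite {y : X // S.R j z y})
  Fintype.ofFinite _

/-- An ordering `E 0, …, E D` of the primitive idempotents of the Bose–Mesner algebra with
`E 0 = |X|⁻¹ J`. (The algebra has dimension `D + 1`, so `D + 1` non-zero pairwise orthogonal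
idempotents in it are exactly its primitive idempotents.) -/
structure Idempotents [Fintype X] (S : AssocScheme X D) where
  E : Fin (D + 1) → Matrix X X ℝ
  mem : ∀ i, E i ∈ S.boseMesner
  zero : E 0 = Matrix.of fun _ _ => (Fintype.card X : ℝ)⁻¹
  ne_zero : ∀ i, E i ≠ 0
  idem : ∀ i, E i * E i = E i
  orthogonal : ∀ i j, i ≠ j → E i * E j = 0

theorem hadamard_mem (S : AssocScheme X D) {M N : Matrix X X ℝ}
    (hM : M ∈ S.boseMesner) (hN : N ∈ S.boseMesner) : M.hadamard N ∈ S.boseMesner := by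
  unfold boseMesner at hM hN ⊢
  induction hM using Submodule.span_induction with
  | zero => simp
  | add a b _ _ ha hb => rw [Matrix.add_hadamard]; exact add_mem ha hb
  | smul c a _ ha => rw [Matrix.smul_hadamard]; exact Submodule.smul_mem _ c ha
  | mem a ha =>
    obtain ⟨i, rfl⟩ := ha
    induction hN using Submodule.span_induction with
    | zero => simp
    | add a b _ _ ha hb => rw [Matrix.hadamard_add]; exact add_mem ha hb
    | smul c a _ ha => rw [Matrix.hadamard_smul]; exact Submodule.smul_mem _ c ha
    | mem b hb =>
      obtain ⟨j, rfl⟩ := hb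
      by_cases hij : i = j
      · subst hij
        have h : (S.A i).hadamard (S.A i) = S.A i := by
          ext x y; simp [A, Matrix.hadamard]
        rw [h]
        exact Submodule.subset_span ⟨i, rfl⟩
      · have h : (S.A i).hadamard (S.A j) = 0 := by
          ext x y
          have := S.partition x y
          simp only [A, Matrix.hadamard, Matrix.of_apply, Matrix.zero_apply]
          by_cases h1 : S.R i x y
          · by_cases h2 : S.R j x y
            · exact absurd (this.unique h1 h2) hij
            · simp [h2]
          · simp [h1]
        rw [h]
        exact zero_mem _

namespace Idempotents

variable [Fintype X] {S : AssocScheme X D}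

theorem exists_eigenmatrix (I : S.Idempotents) (j : Fin (D + 1)) :
    ∃ c : Fin (D + 1) → ℝ, (Fintype.card X : ℝ) • I.E j = ∑ i, c i • S.A i := by
  have h := Submodule.smul_mem _ (Fintype.card X : ℝ) (I.mem j)
  obtain ⟨c, hc⟩ := (Submodule.mem_span_range_iff_exists_fun ℝ).1 h
  exact ⟨c, hc.symm⟩

/-- The second eigenmatrix: `|X| E j = ∑ i, Q i j • A i`. -/
noncomputable def Q (I : S.Idempotents) : Matrix (Fin (D + 1)) (Fin (D + 1)) ℝ :=
  Matrix.of fun i j => Classical.choose (I.exists_eigenmatrix j) i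

theorem Q_spec (I : S.Idempotents) (j : Fin (D + 1)) :
    (Fintype.card X : ℝ) • I.E j = ∑ i, I.Q i j • S.A i :=
  Classical.choose_spec (I.exists_eigenmatrix j)

theorem linearIndependent (I : S.Idempotents) : LinearIndependent ℝ I.E := by
  rw [Fintype.linearIndependent_iff]
  intro g hg i
  have h := congrArg (fun M => M * I.E i) hg
  simp only [Finset.sum_mul, zero_mul, Matrix.smul_mul] at h
  rw [Finset.sum_eq_single i] at h
  · rw [I.idem] at h
    exact (smul_eq_zero.1 h).resolve_right (I.ne_zero i)
  · intro b _ hb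
    rw [I.orthogonal b i hb, smul_zero]
  · simp

theorem span_eq (I : S.Idempotents) : Submodule.span ℝ (Set.range I.E) = S.boseMesner := by
  apply Submodule.eq_of_le_of_finrank_le
  · rw [Submodule.span_le]
    rintro _ ⟨i, rfl⟩
    exact I.mem i
  · rw [finrank_span_eq_card I.linearIndependent]
    exact finrank_range_le_card S.A

theorem exists_krein (I : S.Idempotents) (i j : Fin (D + 1)) :
    ∃ c : Fin (D + 1) → ℝ,
      (I.E i).hadamard (I.E j) = (Fintype.card X : ℝ)⁻¹ • ∑ k, c k • I.E k := by
  have h := Submodule.smul_mem _ (Fintype.card X : ℝ) (S.hadamard_mem (I.mem i) (I.mem j))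
  rw [← I.span_eq] at h
  obtain ⟨c, hc⟩ := (Submodule.mem_span_range_iff_exists_fun ℝ).1 h
  refine ⟨c, ?_⟩
  obtain ⟨x, -⟩ := S.nonempty 0
  have hX : (Fintype.card X : ℝ) ≠ 0 := by
    have : Nonempty X := ⟨x⟩
    exact_mod_cast Fintype.card_ne_zero
  rw [hc, smul_smul, inv_mul_cancel₀ hX, one_smul]

/-- The Krein numbers `q i j k`, that is $q_{ij}^k$:
`E i ∘ E j = |X|⁻¹ ∑ k, q i j k • E k` for the entrywise product `∘`. -/
noncomputable def q (I : S.Idempotents) (i j k : Fin (D + 1)) : ℝ :=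
  Classical.choose (I.exists_krein i j) k

theorem q_spec (I : S.Idempotents) (i j : Fin (D + 1)) :
    (I.E i).hadamard (I.E j) = (Fintype.card X : ℝ)⁻¹ • ∑ k, I.q i j k • I.E k :=
  Classical.choose_spec (I.exists_krein i j)

/-- The Krein matrix `B* i`, with `(j, k)` entry $q_{ij}^k$. -/
noncomputable def kreinMatrix (I : S.Idempotents) (i : Fin (D + 1)) :
    Matrix (Fin (D + 1)) (Fin (D + 1)) ℝ :=
  Matrix.of fun j k => I.q i j k

/-- $a_i^* = q_{1,i}^i$. -/
noncomputable def aStar (I : S.Idempotents) (i : Fin (D + 1)) : ℝ := I.q 1 i i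

/-- $b_i^* = q_{1,i+1}^i$ for `0 ≤ i < D`. -/
noncomputable def bStar (I : S.Idempotents) (i : Fin D) : ℝ := I.q 1 i.succ i.castSucc

/-- `cStar i` is $c_{i+1}^* = q_{1,i}^{i+1}$ for `0 ≤ i < D`. -/
noncomputable def cStar (I : S.Idempotents) (i : Fin D) : ℝ := I.q 1 i.castSucc i.succ

/-- The scheme is `Q`-polynomial with respect to the ordering `E 0, …, E D`: each `|X| E i` is,
for the entrywise product, a polynomial of degree `i` in `|X| E 1`. -/
def IsQPolynomial (I : S.Idempotents) : Prop :=
  ∀ i : Fin (D + 1), ∃ v : Polynomial ℝ, v.natDegree = (i : ℕ) ∧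
    ∀ l, I.Q l i = v.eval (I.Q l 1)

/-- `Q`-bipartite: all $a_i^*$ vanish. -/
def IsQBipartite (I : S.Idempotents) : Prop := ∀ i, I.aStar i = 0

/-- `Q`-antipodal: $b_i^* = c_{D-i}^*$ for all `i`, except possibly `i = ⌊D/2⌋`.
(`Fin.rev i` is `D - 1 - i`, so that `cStar i.rev` is $c_{D-i}^*$; the case `i = D` reads `0 = 0`.) -/
def IsQAntipodal (I : S.Idempotents) : Prop :=
  ∀ i : Fin D, (i : ℕ) ≠ D / 2 → I.bStar i = I.cStar i.rev

/-- The equivalence relation that belongs to the pair `{E 0, E D}`: `x` and `y` are equivalent when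
the rows of `E D` (equivalently of `E 0 + E D`) at `x` and `y` agree. In a `Q`-antipodal scheme its
classes are the `Q`-antipodal classes, and `E 0 + E D` is block diagonal along them,
with constant blocks. -/
def antipodalSetoid (I : S.Idempotents) : Setoid X :=
  Setoid.ker fun x => (fun y => I.E (Fin.last D) x y)

/-- There are exactly `f` antipodal classes, each of size `r`. -/
def HasAntipodalClasses (I : S.Idempotents) (f r : ℕ) : Prop :=
  I.antipodalSetoid.classes.ncard = f ∧ ∀ c ∈ I.antipodalSetoid.classes, c.ncard = r

end Idempotents

end AssocScheme

/-! The Krein parameters force the dual eigenvalues of `E 1` to be $s^2, s, 0, -s, -s^2$ with $s^2 =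
d$. Up to scale, `E 1` is therefore the Gram matrix of $f$ mutually unbiased bases of a
$d$-dimensional space, each taken with both signs: a $Q$-antipodal class is one basis with its
negatives, and `R 4` pairs a vector with its negative (`exists_isUnbiasedFrame`).

Each signed basis is a tight frame (`sum_κ_mul`). Fix $a$. The vectors with inner product $1$ with
$a$ contain exactly one of each pair $\pm w$ outside the class of $a$, so sums of even functions
over this set are half of sums over whole classes (`two_mul_sum_subconstituent`). Moreover $R_3(z) =
R_1(-z)$, so one computation serves both values of $j$.

On the subconstituent let $H$ be the scaled Gram matrix, $K$ the indicator of lying in one basis,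
and $J$ the all-ones matrix. Tightness gives $K^2 = dK$, $HK = KH = sJ$ and $H^2 = (f-1)sH$. Hence
$J, K, H, I$ span a commutative algebra containing the adjacency matrices, which yields the
intersection numbers. The commuting projections $U = K/d$ and $V = H/((f-1)s)$ have $UV = J/|Y|$,
$Y$ being the subconstituent, which yields the primitive idempotents, $Q$ and the Krein matrix. -/

namespace AssocScheme

variable {X : Type*} {D : ℕ}

/-! ### Eigenmatrices and Krein numbers of a general scheme -/

theorem rel_unique (S : AssocScheme X D) {i j : Fin (D + 1)} {x y : X}
    (hi : S.R i x y) (hj : S.R j x y) : i = j :=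
  (S.partition x y).unique hi hj

theorem rel_zero_self (S : AssocScheme X D) (x : X) : S.R 0 x x := (S.diag x x).2 rfl

theorem card_pos [Fintype X] (S : AssocScheme X D) : 0 < (Fintype.card X : ℝ) := by
  obtain ⟨x, -⟩ := S.nonempty 0
  have : Nonempty X := ⟨x⟩
  exact_mod_cast Fintype.card_pos

theorem sum_smul_A_apply (S : AssocScheme X D) (c : Fin (D + 1) → ℝ) {l : Fin (D + 1)} {x y : X}
    (h : S.R l x y) : (∑ i, c i • S.A i) x y = c l := by
  classical
  rw [Matrix.sum_apply, Finset.sum_eq_single l]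
  · simp [A, h]
  · intro b _ hb
    have : ¬ S.R b x y := fun h' => hb (S.rel_unique h' h)
    simp [A, this]
  · simp

theorem isSymm_of_mem (S : AssocScheme X D) {M : Matrix X X ℝ} (hM : M ∈ S.boseMesner) (x y : X) :
    M x y = M y x := by
  obtain ⟨c, rfl⟩ := (Submodule.mem_span_range_iff_exists_fun ℝ).1 hM
  obtain ⟨l, hl, -⟩ := S.partition x y
  rw [S.sum_smul_A_apply c hl, S.sum_smul_A_apply c (S.symm _ _ _ hl)]

theorem one_mem [DecidableEq X] (S : AssocScheme X D) : (1 : Matrix X X ℝ) ∈ S.boseMesner := by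
  have : (1 : Matrix X X ℝ) = S.A 0 := by
    ext x y
    simp [A, Matrix.one_apply, S.diag]
  rw [this]
  exact Submodule.subset_span ⟨0, rfl⟩

namespace Idempotents

variable [Fintype X] {S : AssocScheme X D} (I : S.Idempotents)

theorem card_mul_E {l : Fin (D + 1)} {x y : X} (h : S.R l x y) (j : Fin (D + 1)) :
    (Fintype.card X : ℝ) * I.E j x y = I.Q l j := by
  have := congrFun (congrFun (I.Q_spec j) x) y
  rw [S.sum_smul_A_apply (fun i => I.Q i j) h] at this
  simpa using this

theorem E_apply {l : Fin (D + 1)} {x y : X} (h : S.R l x y) (j : Fin (D + 1)) :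
    I.E j x y = I.Q l j / Fintype.card X := by
  rw [← I.card_mul_E h j, mul_div_cancel_left₀ _ S.card_pos.ne']

theorem E_symm (j : Fin (D + 1)) (x y : X) : I.E j x y = I.E j y x :=
  S.isSymm_of_mem (I.mem j) x y

theorem Q_unique {c : Fin (D + 1) → ℝ} {j : Fin (D + 1)}
    (h : (Fintype.card X : ℝ) • I.E j = ∑ i, c i • S.A i) (l : Fin (D + 1)) : I.Q l j = c l := by
  obtain ⟨x, y, hl⟩ := S.nonempty l
  rw [← I.card_mul_E hl j, ← S.sum_smul_A_apply c hl, ← h]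
  simp

theorem Q_zero (l : Fin (D + 1)) : I.Q l 0 = 1 := by
  obtain ⟨x, y, hl⟩ := S.nonempty l
  rw [← I.card_mul_E hl, I.zero]
  simp [S.card_pos.ne']

/-- The `E k` are linearly independent, so entrywise products of columns of $Q$ determine the Krein
numbers; this is how a Krein matrix is read off an explicit $Q$. -/
theorem q_unique {c : Fin (D + 1) → ℝ} {i j : Fin (D + 1)}
    (h : ∀ l, I.Q l i * I.Q l j = ∑ k, c k * I.Q l k) (k : Fin (D + 1)) : I.q i j k = c k := by
  have hn := S.card_pos.ne'
  have h2 : ∑ k, I.q i j k • I.E k = ∑ k, c k • I.E k := by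
    have h1 := I.q_spec i j
    rw [eq_inv_smul_iff₀ hn] at h1
    rw [← h1]
    ext x y
    obtain ⟨l, hl, -⟩ := S.partition x y
    simp only [Matrix.smul_apply, Matrix.hadamard_apply, Matrix.sum_apply, I.E_apply hl, smul_eq_mul]
    simp_rw [← mul_div_assoc, ← Finset.sum_div, ← h l]
    field_simp
  have h3 : ∑ k, (I.q i j k - c k) • I.E k = 0 := by
    simp [sub_smul, Finset.sum_sub_distrib, h2]
  have := Fintype.linearIndependent_iff.1 I.linearIndependent _ h3 k
  linarith

theorem Q_mul_Q (l i j : Fin (D + 1)) : I.Q l i * I.Q l j = ∑ k, I.q i j k * I.Q l k := by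
  have hn := S.card_pos.ne'
  obtain ⟨x, y, hl⟩ := S.nonempty l
  have h1 := congrFun (congrFun (I.q_spec i j) x) y
  simp only [Matrix.smul_apply, Matrix.hadamard_apply, Matrix.sum_apply, I.E_apply hl,
    smul_eq_mul] at h1
  simp_rw [← mul_div_assoc, ← Finset.sum_div] at h1
  field_simp at h1
  exact h1

theorem q_zero_right (i k : Fin (D + 1)) : I.q i 0 k = if k = i then 1 else 0 :=
  I.q_unique (c := fun k => if k = i then 1 else 0) (by simp [I.Q_zero]) k

theorem sum_E [DecidableEq X] : ∑ k, I.E k = 1 := by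
  have h := S.one_mem
  rw [← I.span_eq] at h
  obtain ⟨c, hc⟩ := (Submodule.mem_span_range_iff_exists_fun ℝ).1 h
  rw [← hc]
  refine Finset.sum_congr rfl fun k _ => ?_
  have h2 := congrArg (fun M => M * I.E k) hc
  simp only [Finset.sum_mul, one_mul, Matrix.smul_mul] at h2
  rw [Finset.sum_eq_single k (fun b _ hb => by rw [I.orthogonal b k hb, smul_zero]) (by simp),
    I.idem] at h2
  exact h2.symm

theorem sum_E_mul_E (i j : Fin (D + 1)) (x y : X) :
    ∑ w, I.E i x w * I.E j w y = if i = j then I.E i x y else 0 := by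
  rw [← Matrix.mul_apply]
  split_ifs with h
  · rw [← h, I.idem]
  · rw [I.orthogonal i j h]; rfl

/-- $Q_{0j}/|X|$ is the squared norm of every row of `E j`. -/
theorem Q_zero_pos (j : Fin (D + 1)) : 0 < I.Q 0 j := by
  have hn := S.card_pos
  have key : ∀ x, ∑ w, I.E j x w ^ 2 = I.Q 0 j / Fintype.card X := fun x => by
    have := I.sum_E_mul_E j j x x
    rw [if_pos rfl, I.E_apply (S.rel_zero_self x)] at this
    rw [← this]
    exact Finset.sum_congr rfl fun w _ => by rw [I.E_symm j w x, sq]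
  obtain ⟨x, -⟩ := S.nonempty 0
  have h0 : 0 ≤ I.Q 0 j / Fintype.card X := by
    rw [← key x]
    exact Finset.sum_nonneg fun _ _ => sq_nonneg _
  rcases h0.lt_or_eq with h | h
  · rwa [div_pos_iff_of_pos_right hn] at h
  · refine absurd ?_ (I.ne_zero j)
    ext x y
    have := (Finset.sum_eq_zero_iff_of_nonneg fun w _ => sq_nonneg (I.E j x w)).1
      ((key x).trans h.symm) y (Finset.mem_univ y)
    simpa using this

theorem trace_E (k : Fin (D + 1)) : ∑ x, I.E k x x = I.Q 0 k := by
  simp only [fun x => I.E_apply (S.rel_zero_self x) k]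
  simp
  field_simp [S.card_pos.ne']

theorem sum_triple (i j k : Fin (D + 1)) :
    ∑ x, ∑ y, I.E i x y * I.E j x y * I.E k x y = I.q i j k * I.Q 0 k / Fintype.card X := by
  have h1 : ∀ x y, I.E i x y * I.E j x y * I.E k x y =
      ∑ l, (Fintype.card X : ℝ)⁻¹ * I.q i j l * (I.E l x y * I.E k y x) := fun x y => by
    have := congrFun (congrFun (I.q_spec i j) x) y
    simp only [Matrix.smul_apply, Matrix.hadamard_apply, Matrix.sum_apply, smul_eq_mul] at this
    rw [this, Finset.mul_sum, Finset.sum_mul, I.E_symm k x y]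
    exact Finset.sum_congr rfl fun l _ => by ring
  have h2 : ∀ x, ∑ y, I.E i x y * I.E j x y * I.E k x y =
      (Fintype.card X : ℝ)⁻¹ * I.q i j k * I.E k x x := fun x => by
    simp_rw [h1]
    rw [Finset.sum_comm]
    simp_rw [← Finset.mul_sum, I.sum_E_mul_E]
    rw [Finset.sum_eq_single k (fun b _ hb => by simp [hb]) (by simp)]
    simp
  simp_rw [h2, ← Finset.mul_sum, I.trace_E]
  ring

/-- Both sides are $|X|$ times the same sum of entries of $E_i \circ E_j \circ E_k$, which is
symmetric in the three indices. -/
theorem q_mul_symm (i j k : Fin (D + 1)) : I.q i j k * I.Q 0 k = I.q i k j * I.Q 0 j := by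
  have hn := S.card_pos.ne'
  have h : I.q i j k * I.Q 0 k / Fintype.card X = I.q i k j * I.Q 0 j / Fintype.card X := by
    rw [← I.sum_triple, ← I.sum_triple]
    exact Finset.sum_congr rfl fun x _ => Finset.sum_congr rfl fun y _ => by ring
  field_simp at h
  exact h

theorem q_eq_zero_symm {i j k : Fin (D + 1)} (h : I.q i j k = 0) : I.q i k j = 0 := by
  have := I.q_mul_symm i j k
  rw [h, zero_mul] at this
  exact (mul_eq_zero.1 this.symm).resolve_right (I.Q_zero_pos j).ne'

/-- Summing the triple sum over $j$ replaces `E j` by the identity, leaving only diagonal entries.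
-/
theorem sum_q (i k : Fin (D + 1)) : ∑ j, I.q i j k = I.Q 0 i := by
  classical
  have hn := S.card_pos.ne'
  have hsum : ∀ x y, ∑ j, I.E j x y = (1 : Matrix X X ℝ) x y := fun x y => by
    rw [← I.sum_E, Matrix.sum_apply]
  have h1 : ∑ j, I.q i j k * I.Q 0 k / Fintype.card X = I.Q 0 i * I.Q 0 k / Fintype.card X := by
    simp_rw [← I.sum_triple]
    rw [Finset.sum_comm]
    have : ∀ x, ∑ j, ∑ y, I.E i x y * I.E j x y * I.E k x y = I.E i x x * I.E k x x := fun x => by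
      rw [Finset.sum_comm]
      simp_rw [← Finset.sum_mul, ← Finset.mul_sum, hsum, Matrix.one_apply]
      simp
    simp_rw [this, fun x => I.E_apply (S.rel_zero_self x)]
    simp
    field_simp
  rw [← Finset.sum_div, ← Finset.sum_mul] at h1
  field_simp at h1
  exact mul_right_cancel₀ (I.Q_zero_pos k).ne' (h1.trans (mul_comm _ _))

theorem Q_one_injective (h : ∀ i j, i < j → I.Q j 1 < I.Q i 1) :
    Function.Injective fun l => I.Q l 1 := by
  intro a b hab
  rcases lt_trichotomy a b with h1 | h1 | h1
  · exact absurd hab (h _ _ h1).ne'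
  · exact h1
  · exact absurd hab (h _ _ h1).ne

/-- In a `Q`-polynomial scheme $q_{1j}^k = 0$ for `k > j + 1`. -/
theorem IsQPolynomial.q_eq_zero {I : S.Idempotents} (hpoly : I.IsQPolynomial)
    (hinj : Function.Injective fun l => I.Q l 1) {j k : Fin (D + 1)} (hjk : (j : ℕ) + 1 < k) :
    I.q 1 j k = 0 := by
  choose v hdeg hv using hpoly
  set P : Polynomial ℝ := Polynomial.X * v j - ∑ k, Polynomial.C (I.q 1 j k) * v k with hP
  have hPdeg : P.natDegree ≤ D := by
    refine (Polynomial.natDegree_sub_le _ _).trans (max_le ?_ ?_)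
    · refine Polynomial.natDegree_mul_le.trans ?_
      rw [hdeg, Polynomial.natDegree_X]
      omega
    · refine Polynomial.natDegree_sum_le_of_forall_le _ _ fun l _ => ?_
      refine (Polynomial.natDegree_C_mul_le _ _).trans ?_
      rw [hdeg]
      omega
  -- The degree is at most $D$, while the $D + 1$ distinct numbers $Q_{l1}$ are all roots.
  have hP0 : P = 0 := by
    refine Polynomial.eq_zero_of_natDegree_lt_card_of_eval_eq_zero P hinj (fun l => ?_) ?_
    · simp only [hP, Polynomial.eval_sub, Polynomial.eval_mul, Polynomial.eval_X,
        Polynomial.eval_finsetSum, Polynomial.eval_C, ← hv]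
      rw [I.Q_mul_Q, sub_self]
    · simpa using Nat.lt_succ_of_le hPdeg
  -- Descending induction on $k$: once the higher Krein numbers vanish, only $v_k$ contributes to
  -- the coefficient of $X^k$.
  have main : ∀ n : ℕ, ∀ k : Fin (D + 1), (j : ℕ) + 1 < k → D - (k : ℕ) = n → I.q 1 j k = 0 := by
    intro n
    induction n using Nat.strong_induction_on with
    | _ n ih =>
      intro k hk hn
      have hc := congrArg (fun p => p.coeff (k : ℕ)) hP0
      simp only [hP, Polynomial.coeff_sub, Polynomial.finsetSum_coeff, Polynomial.coeff_C_mul,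
        Polynomial.coeff_zero] at hc
      rw [Polynomial.coeff_eq_zero_of_natDegree_lt, Finset.sum_eq_single k] at hc
      · have hlead : (v k).coeff (k : ℕ) ≠ 0 := by
          have hne : v k ≠ 0 := by
            rintro h0
            have := hdeg k
            rw [h0, Polynomial.natDegree_zero] at this
            omega
          have := Polynomial.leadingCoeff_ne_zero.2 hne
          rwa [Polynomial.leadingCoeff, hdeg] at this
        have : I.q 1 j k * (v k).coeff (k : ℕ) = 0 := by linarith
        exact (mul_eq_zero.1 this).resolve_right hlead
      · intro b _ hb
        rcases lt_or_gt_of_ne hb with h | h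
        · rw [Polynomial.coeff_eq_zero_of_natDegree_lt (by rw [hdeg]; exact h), mul_zero]
        · have hb' : (k : ℕ) < b := h
          have := b.is_lt
          rw [ih (D - b) (by omega) b (by omega) rfl, zero_mul]
      · simp
      · refine Polynomial.natDegree_mul_le.trans_lt ?_
        rw [hdeg, Polynomial.natDegree_X]
        omega
  exact main _ k hjk rfl

end Idempotents

end AssocScheme

/-! ### Dual eigenvalues of the four-class scheme -/

namespace AssocScheme

namespace Idempotents

variable {X : Type*} [Fintype X] {S : AssocScheme X 4} {I : S.Idempotents}

/-- The first Krein matrix is tridiagonal with zero diagonal and constant column sums $m = Q_{01}$;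
$b_1^* = c_3^*$ then leaves only $m$ and $c_2^*$ as parameters. -/
theorem dual_recurrence (hpoly : I.IsQPolynomial) (hanti : I.IsQAntipodal)
    (hbip : I.IsQBipartite) (hinj : Function.Injective fun l => I.Q l 1) (l : Fin (4 + 1)) :
    I.Q l 1 ^ 2 = I.Q 0 1 + I.q 1 1 2 * I.Q l 2 ∧
    I.Q l 1 * I.Q l 2 = (I.Q 0 1 - 1) * (I.Q l 1 + I.Q l 3) ∧
    I.Q l 1 * I.Q l 3 = (I.Q 0 1 - I.q 1 1 2) * I.Q l 2 + I.Q 0 1 * I.Q l 4 ∧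
    I.Q l 1 * I.Q l 4 = I.Q l 3 := by
  have q0 : ∀ k, I.q 1 0 k = if k = 1 then 1 else 0 := I.q_zero_right 1
  have z02 : I.q 1 0 2 = 0 := by simp [q0]
  have z03 : I.q 1 0 3 = 0 := by simp [q0]
  have z04 : I.q 1 0 4 = 0 := by simp [q0]
  have z01 : I.q 1 0 1 = 1 := by simp [q0]
  have z00 : I.q 1 0 0 = 0 := hbip 0
  have z11 : I.q 1 1 1 = 0 := hbip 1
  have z22 : I.q 1 2 2 = 0 := hbip 2
  have z33 : I.q 1 3 3 = 0 := hbip 3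
  have z44 : I.q 1 4 4 = 0 := hbip 4
  have z13 : I.q 1 1 3 = 0 := hpoly.q_eq_zero hinj (by decide)
  have z14 : I.q 1 1 4 = 0 := hpoly.q_eq_zero hinj (by decide)
  have z24 : I.q 1 2 4 = 0 := hpoly.q_eq_zero hinj (by decide)
  have z20 := I.q_eq_zero_symm z02
  have z30 := I.q_eq_zero_symm z03
  have z40 := I.q_eq_zero_symm z04
  have z31 := I.q_eq_zero_symm z13
  have z41 := I.q_eq_zero_symm z14
  have z42 := I.q_eq_zero_symm z24
  have s0 := (Fin.sum_univ_five _).symm.trans (I.sum_q 1 0)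
  have s1 := (Fin.sum_univ_five _).symm.trans (I.sum_q 1 1)
  have s2 := (Fin.sum_univ_five _).symm.trans (I.sum_q 1 2)
  have s3 := (Fin.sum_univ_five _).symm.trans (I.sum_q 1 3)
  have s4 := (Fin.sum_univ_five _).symm.trans (I.sum_q 1 4)
  have h1 := (I.Q_mul_Q l 1 1).trans (Fin.sum_univ_five _)
  have h2 := (I.Q_mul_Q l 1 2).trans (Fin.sum_univ_five _)
  have h3 := (I.Q_mul_Q l 1 3).trans (Fin.sum_univ_five _)
  have h4 := (I.Q_mul_Q l 1 4).trans (Fin.sum_univ_five _)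
  have hb : I.q 1 2 1 = I.q 1 2 3 := hanti 1 (by decide)
  simp only [z00, z01, z02, z03, z04, z11, z13, z14, z20, z22, z24, z30, z31,
    z33, z40, z41, z42, z44, I.Q_zero, zero_mul, zero_add, add_zero, mul_one] at s0 s1 s2 s3 s4 h1 h2 h3 h4
  have e1 : I.q 1 2 1 = I.Q 0 1 - 1 := by linarith
  have e2 : I.q 1 2 3 = I.Q 0 1 - 1 := by linarith
  have e3 : I.q 1 3 2 = I.Q 0 1 - I.q 1 1 2 := by linarith
  have e4 : I.q 1 4 3 = 1 := by linarith
  rw [e1, e2] at h2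
  rw [e3, s4] at h3
  rw [e4] at h4
  rw [s0] at h1
  refine ⟨by rw [sq, h1], by rw [h2]; ring, h3, by rw [h4]; ring⟩

theorem natural_eigenvalues (hpoly : I.IsQPolynomial) (hanti : I.IsQAntipodal)
    (hbip : I.IsQBipartite) (hnat : ∀ i j : Fin 5, i < j → I.Q j 1 < I.Q i 1) :
    ∃ s F : ℝ, 1 < s ∧ F ≠ 0 ∧
      (∀ l, I.Q l 1 = s * (![s, 1, 0, -1, -s] : Fin 5 → ℝ) l) ∧
      ∀ l, I.Q l 4 = (![F - 1, -1, F - 1, -1, F - 1] : Fin 5 → ℝ) l := by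
  have hrec := dual_recurrence hpoly hanti hbip (I.Q_one_injective hnat)
  have hm := I.Q_zero_pos 1
  set m := I.Q 0 1 with hmdef
  set μ := I.q 1 1 2
  have h01 : I.Q 1 1 < m := hnat 0 1 (by decide)
  have h12 : I.Q 2 1 < I.Q 1 1 := hnat 1 2 (by decide)
  have h23 : I.Q 3 1 < I.Q 2 1 := hnat 2 3 (by decide)
  have h34 : I.Q 4 1 < I.Q 3 1 := hnat 3 4 (by decide)
  -- Otherwise three distinct dual eigenvalues would have the same square $m$.
  have hμ : μ ≠ 0 := by
    intro h0
    have a0 := (hrec 0).1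
    have a1 := (hrec 1).1
    have a2 := (hrec 2).1
    rw [h0, zero_mul, add_zero] at a0 a1 a2
    rcases sq_eq_sq_iff_eq_or_eq_neg.1 (a0.trans a1.symm) with h | h <;>
    rcases sq_eq_sq_iff_eq_or_eq_neg.1 (a0.trans a2.symm) with h' | h' <;> linarith
  obtain ⟨s, hs0, hs⟩ : ∃ s : ℝ, 0 < s ∧ s ^ 2 = m := ⟨√m, Real.sqrt_pos.2 hm, Real.sq_sqrt hm.le⟩
  have hroots : ∀ l, I.Q l 1 = 0 ∨ I.Q l 1 = s ∨ I.Q l 1 = -s ∨ I.Q l 1 = m ∨ I.Q l 1 = -m := by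
    intro l
    obtain ⟨r1, r2, r3, r4⟩ := hrec l
    set θ := I.Q l 1
    -- Eliminating $Q_{l2}, Q_{l3}, Q_{l4}$ from the recurrences leaves the quintic $\theta(\theta^2
    -- - m)(\theta^2 - m^2)$, whose roots must be the five dual eigenvalues.
    have key : θ * ((θ - s) * (θ + s) * ((θ - m) * (θ + m))) = 0 := by
      have : θ * ((θ ^ 2 - s ^ 2) * (θ ^ 2 - m ^ 2)) = 0 := by
        have hP : θ ^ 3 - m * θ - μ * (m - 1) * θ = μ * (m - 1) * I.Q l 3 := by
          linear_combination θ * r1 + μ * r2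
        have e : θ ^ 2 * I.Q l 3 = (m - μ) * (θ * I.Q l 2) + m * I.Q l 3 := by
          linear_combination θ * r3 + m * r4
        rw [hs]
        linear_combination (θ ^ 2 - m) * hP + μ * (m - 1) * e - (m - μ) * (m - 1) * θ * r1
      linear_combination this
    simp only [mul_eq_zero, sub_eq_zero, add_eq_zero_iff_eq_neg] at key
    tauto
  have r1 := hroots 1
  have r2 := hroots 2
  have r3 := hroots 3
  have r4 := hroots 4
  -- If $s \le 1$ then $m \le s$. As $m$ is the largest dual eigenvalue, the four smaller ones would
  -- have to fit into $\{0, -m, -s\}$.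
  have hs1 : 1 < s := by
    by_contra! hle
    have hms : m ≤ s := by nlinarith
    have u1 : I.Q 1 1 ≤ 0 := by rcases r1 with h | h | h | h | h <;> linarith
    have u2 : I.Q 2 1 ≤ -m := by rcases r2 with h | h | h | h | h <;> linarith
    have u3 : I.Q 3 1 ≤ -s := by rcases r3 with h | h | h | h | h <;> linarith
    rcases r4 with h | h | h | h | h <;> linarith
  have hsm : s < m := by nlinarith
  have hm1 : m - 1 ≠ 0 := by linarith
  have u1 : I.Q 1 1 ≤ s := by rcases r1 with h | h | h | h | h <;> linarith
  have u2 : I.Q 2 1 ≤ 0 := by rcases r2 with h | h | h | h | h <;> linarith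
  have u3 : I.Q 3 1 ≤ -s := by rcases r3 with h | h | h | h | h <;> linarith
  have t4 : I.Q 4 1 = -m := by rcases r4 with h | h | h | h | h <;> linarith
  have t3 : I.Q 3 1 = -s := by rcases r3 with h | h | h | h | h <;> linarith
  have t2 : I.Q 2 1 = 0 := by rcases r2 with h | h | h | h | h <;> linarith
  have t1 : I.Q 1 1 = s := by rcases r1 with h | h | h | h | h <;> linarith
  have hC : ∀ l, I.Q l 1 ≠ 0 → (m - 1) * (1 + I.Q l 4) = I.Q l 2 := fun l hl => by
    obtain ⟨-, r2, -, r4⟩ := hrec l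
    refine mul_left_cancel₀ hl ?_
    linear_combination -r2 + (m - 1) * r4
  have hfar : ∀ l, I.Q l 1 ^ 2 = m ^ 2 → I.Q l 4 = m / μ - 1 := fun l hl => by
    have hne : I.Q l 1 ≠ 0 := by
      rintro h0
      rw [h0] at hl
      nlinarith
    have h1 := (hrec l).1
    rw [eq_sub_iff_add_eq, eq_div_iff hμ]
    refine mul_left_cancel₀ hm1 ?_
    linear_combination μ * hC l hne - h1 + hl
  have hnear : ∀ l, I.Q l 1 ^ 2 = m → I.Q l 4 = -1 := fun l hl => by
    have hne : I.Q l 1 ≠ 0 := by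
      rintro h0
      rw [h0] at hl
      nlinarith
    have h1 := (hrec l).1
    have : μ * (m - 1) * (1 + I.Q l 4) = 0 := by
      linear_combination μ * hC l hne - h1 + hl
    have := (mul_eq_zero.1 this).resolve_left (mul_ne_zero hμ hm1)
    linarith
  -- Here $\theta = 0$, so `hC` says nothing and the first three recurrences are solved directly.
  have hmid : I.Q 2 4 = m / μ - 1 := by
    obtain ⟨p1, p2, p3, -⟩ := hrec 2
    rw [t2] at p1 p2 p3
    have hB : I.Q 2 3 = 0 := by
      refine (mul_eq_zero.1 (?_ : (m - 1) * I.Q 2 3 = 0)).resolve_left hm1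
      linarith
    rw [eq_sub_iff_add_eq, eq_div_iff hμ]
    refine mul_left_cancel₀ hm.ne' ?_
    linear_combination -μ * p3 + (m - μ) * p1
  refine ⟨s, m / μ, hs1, div_ne_zero hm.ne' hμ, fun l => ?_, fun l => ?_⟩
  · fin_cases l
    · simpa [← sq, hs] using hmdef.symm
    · simpa using t1
    · simpa using t2
    · simpa using t3
    · simpa [← sq, hs] using t4
  · fin_cases l
    · exact hfar 0 rfl
    · exact hnear 1 (by rw [t1, hs])
    · exact hmid
    · exact hnear 3 (by rw [t3, neg_sq, hs])
    · exact hfar 4 (by rw [t4, neg_sq])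

end Idempotents

end AssocScheme

/-! ### From the four-class scheme to mutually unbiased signed bases -/

theorem Setoid.ncard_classes_mul {X : Type*} [Fintype X] (r : Setoid X) {k : ℕ}
    (h : ∀ c ∈ r.classes, c.ncard = k) : r.classes.ncard * k = Fintype.card X := by
  classical
  have h1 := r.isPartition_classes.ncard_eq_finsum Set.univ
  rw [Set.ncard_univ, Nat.card_eq_fintype_card, finsum_eq_sum_of_fintype] at h1
  rw [h1, Finset.sum_congr rfl fun c _ => by rw [Set.univ_inter, h c c.2]]
  rw [Finset.sum_const, smul_eq_mul, Finset.card_univ, ← Nat.card_eq_fintype_card]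
  rfl

theorem Set.ncard_eq_sum_indicator {X : Type*} [Fintype X] (p : X → Prop) (κ : X → ℝ)
    (h1 : ∀ x, p x → κ x = 1) (h0 : ∀ x, ¬ p x → κ x = 0) : ({x | p x}.ncard : ℝ) = ∑ x, κ x := by
  classical
  rw [Set.ncard_eq_toFinset_card', Set.toFinset_ofPred, Finset.card_filter]
  push_cast
  refine Finset.sum_congr rfl fun x _ => ?_
  split_ifs with h
  · exact (h1 x h).symm
  · exact (h0 x h).symm

namespace AssocScheme

variable {X : Type*}

/-- The relations of a four-class scheme are recorded by the inner products `h` of a system of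
`f` mutually unbiased orthogonal frames in dimension `d = s ^ 2`; `κ` is the indicator of lying in
the same frame and `σ` is the antipodal map. -/
structure IsUnbiasedFrame [Fintype X] (S : AssocScheme X 4) (f d : ℕ) (s : ℝ) (h κ : X → X → ℝ)
    (σ : X → X) : Prop where
  one_lt : 1 < s
  sq_eq : s ^ 2 = d
  h_val : ∀ l x y, S.R l x y → h x y = (![s, 1, 0, -1, -s] : Fin 5 → ℝ) l
  κ_val : ∀ l x y, S.R l x y → κ x y = (![1, 0, 1, 0, 1] : Fin 5 → ℝ) l
  κ_congr : ∀ x y, κ x y = 1 → ∀ w, κ x w = κ y w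
  κ_sum : ∀ x, ∑ w, κ x w = 2 * d
  card_eq : (Fintype.card X : ℝ) = 2 * d * f
  h_sum : ∀ x y, ∑ w, h x w * h w y = 2 * f * s * h x y
  rel_σ : ∀ x, S.R 4 x (σ x)
  h_σ : ∀ x y, h (σ x) y = -h x y

theorem rel_cases (S : AssocScheme X 4) (x y : X) :
    S.R 0 x y ∨ S.R 1 x y ∨ S.R 2 x y ∨ S.R 3 x y ∨ S.R 4 x y := by
  obtain ⟨l, hl, -⟩ := S.partition x y
  fin_cases l
  · exact .inl hl
  · exact .inr (.inl hl)
  · exact .inr (.inr (.inl hl))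
  · exact .inr (.inr (.inr (.inl hl)))
  · exact .inr (.inr (.inr (.inr hl)))

theorem injective_natural_values {s : ℝ} (hs : 1 < s) :
    Function.Injective (![s, 1, 0, -1, -s] : Fin 5 → ℝ) := by
  intro a b hab
  fin_cases a <;> fin_cases b <;> simp at hab ⊢ <;> linarith

/-- The valency $p_{ll}^0$ does not depend on the point, and it is positive because $R_l$ is
non-empty. -/
theorem exists_rel [Finite X] (S : AssocScheme X 4) (l : Fin 5) (x : X) : ∃ y, S.R l x y := by
  obtain ⟨a, b, hab⟩ := S.nonempty l
  have h1 := S.regular l l 0 a a (S.rel_zero_self a)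
  have h2 := S.regular l l 0 x x (S.rel_zero_self x)
  have hpos : 0 < {w | S.R l a w ∧ S.R l w a}.ncard :=
    (Set.ncard_pos (Set.toFinite _)).2 ⟨b, hab, S.symm _ _ _ hab⟩
  rw [h1, ← h2] at hpos
  obtain ⟨y, hy, -⟩ := (Set.ncard_pos (Set.toFinite _)).1 hpos
  exact ⟨y, hy⟩

theorem Idempotents.exists_isUnbiasedFrame [Fintype X] {S : AssocScheme X 4} {I : S.Idempotents}
    (hpoly : I.IsQPolynomial) (hanti : I.IsQAntipodal) (hbip : I.IsQBipartite)
    (hnat : ∀ i j : Fin 5, i < j → I.Q j 1 < I.Q i 1)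
    {f d : ℕ} (hclasses : I.HasAntipodalClasses f (2 * d)) :
    ∃ s h κ σ, S.IsUnbiasedFrame f d s h κ σ := by
  obtain ⟨s, F, hs, hF, hθ, hφ⟩ := natural_eigenvalues hpoly hanti hbip hnat
  have hn := S.card_pos
  have hs0 : s ≠ 0 := by linarith
  set n : ℝ := (Fintype.card X : ℝ) with hndef
  let h : X → X → ℝ := fun x y => n / s * I.E 1 x y
  let κ : X → X → ℝ := fun x y => (n * I.E 4 x y + 1) / F
  have h_val : ∀ l x y, S.R l x y → h x y = (![s, 1, 0, -1, -s] : Fin 5 → ℝ) l := by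
    intro l x y hl
    simp only [h]
    rw [I.E_apply hl, hθ, ← hndef]
    field_simp
  have κ_val : ∀ l x y, S.R l x y → κ x y = (![1, 0, 1, 0, 1] : Fin 5 → ℝ) l := by
    intro l x y hl
    simp only [κ]
    rw [hndef, I.card_mul_E hl, hφ]
    fin_cases l <;> simp [hF]
  have h_symm : ∀ x y, h x y = h y x := fun x y => by simp only [h, I.E_symm 1 x y]
  have h_self : ∀ x, h x x = s := fun x => h_val 0 x x (S.rel_zero_self x)
  have κ_self : ∀ x, κ x x = 1 := fun x => κ_val 0 x x (S.rel_zero_self x)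
  have h_sum : ∀ x y, ∑ w, h x w * h w y = n / s * h x y := by
    intro x y
    have := I.sum_E_mul_E 1 1 x y
    rw [if_pos rfl] at this
    simp only [h]
    rw [← this, Finset.mul_sum, Finset.mul_sum]
    exact Finset.sum_congr rfl fun w _ => by ring
  have E4_eq : ∀ x y, I.E 4 x y = (F * κ x y - 1) / n := fun x y => by
    simp only [κ]
    field_simp
    ring
  have κ_zero_or_one : ∀ x y, κ x y = 0 ∨ κ x y = 1 := fun x y => by
    rcases S.rel_cases x y with hr | hr | hr | hr | hr <;> rw [κ_val _ _ _ hr] <;> simp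
  have E4_congr : ∀ x y, κ x y = 1 → ∀ w, I.E 4 x w = I.E 4 y w := by
    intro x y hxy w
    -- The squared distance of the two rows is $E_4(x,x) - 2E_4(x,y) + E_4(y,y)$, since `E 4` is a
    -- symmetric idempotent.
    have e : ∑ w, (I.E 4 x w - I.E 4 y w) ^ 2 = 0 := by
      have e1 := I.sum_E_mul_E 4 4 x x
      have e2 := I.sum_E_mul_E 4 4 x y
      have e3 := I.sum_E_mul_E 4 4 y y
      rw [if_pos rfl, E4_eq x x, κ_self] at e1
      rw [if_pos rfl, E4_eq x y, hxy] at e2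
      rw [if_pos rfl, E4_eq y y, κ_self] at e3
      have : ∀ w, (I.E 4 x w - I.E 4 y w) ^ 2 = I.E 4 x w * I.E 4 w x
          - 2 * (I.E 4 x w * I.E 4 w y) + I.E 4 y w * I.E 4 w y := fun w => by
        rw [I.E_symm 4 w x, I.E_symm 4 w y]; ring
      simp_rw [this]
      rw [Finset.sum_add_distrib, Finset.sum_sub_distrib, ← Finset.mul_sum, e1, e2, e3]
      ring
    have := (Finset.sum_eq_zero_iff_of_nonneg fun w _ => sq_nonneg _).1 e w (Finset.mem_univ w)
    exact sub_eq_zero.1 (pow_eq_zero_iff two_ne_zero |>.1 this)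
  have κ_congr : ∀ x y, κ x y = 1 → ∀ w, κ x w = κ y w := fun x y hxy w => by
    simp only [κ, E4_congr x y hxy w]
  have setoid_iff : ∀ x y, I.antipodalSetoid x y ↔ κ y x = 1 := by
    intro x y
    constructor
    · intro hxy
      have h1 : I.E 4 x x = I.E 4 y x := congrFun hxy x
      rw [← κ_self x]
      simp only [κ, h1]
    · intro hxy
      exact funext fun w => (E4_congr y x hxy w).symm
  have κ_sum : ∀ x, ∑ w, κ x w = 2 * d := by
    intro x
    have h1 := hclasses.2 _ (I.antipodalSetoid.mem_classes x)
    rw [← Set.ncard_eq_sum_indicator (fun w => I.antipodalSetoid w x) (κ x)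
      (fun w hw => (setoid_iff w x).1 hw)
      (fun w hw => (κ_zero_or_one x w).resolve_right fun h' => hw ((setoid_iff w x).2 h')), h1]
    push_cast
    ring
  have card_eq : n = 2 * d * f := by
    have h1 := I.antipodalSetoid.ncard_classes_mul hclasses.2
    rw [hclasses.1] at h1
    rw [hndef, ← h1]
    push_cast
    ring
  choose σ hσ using S.exists_rel 4
  have h_σ : ∀ x y, h (σ x) y = -h x y := by
    intro x y
    -- The squared norm of the sum of the two rows is a multiple of $s - 2s + s = 0$.
    have e : ∑ w, (h (σ x) w + h x w) ^ 2 = 0 := by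
      have : ∀ w, (h (σ x) w + h x w) ^ 2 = h (σ x) w * h w (σ x)
          + 2 * (h x w * h w (σ x)) + h x w * h w x := fun w => by
        rw [h_symm w (σ x), h_symm w x]; ring
      simp_rw [this]
      rw [Finset.sum_add_distrib, Finset.sum_add_distrib, ← Finset.mul_sum, h_sum, h_sum, h_sum,
        h_self, h_self, h_val 4 _ _ (hσ x)]
      simp
      ring
    have := (Finset.sum_eq_zero_iff_of_nonneg fun w _ => sq_nonneg _).1 e y (Finset.mem_univ y)
    exact eq_neg_of_add_eq_zero_left (pow_eq_zero_iff two_ne_zero |>.1 this)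
  have h_eq_s : ∀ x y, h x y = s → x = y := by
    intro x y hxy
    obtain ⟨l, hl, -⟩ := S.partition x y
    have : l = 0 := injective_natural_values hs ((h_val _ _ _ hl).symm.trans hxy)
    rw [this] at hl
    exact (S.diag x y).1 hl
  have σ_unique : ∀ x y, S.R 4 x y → y = σ x := fun x y hxy => by
    refine (h_eq_s (σ x) y ?_).symm
    rw [h_σ, h_val 4 _ _ hxy]
    simp
  -- A row of $h$ has squared norm $n$. Its entries are $\pm s$ at $x$ and $\sigma x$, zero on the
  -- rest of the class of $x$, and $\pm 1$ at the other $n - 2d$ points; so $2s^2 + n - 2d = n$.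
  have sq_eq : s ^ 2 = d := by
    classical
    obtain ⟨x, -⟩ := S.nonempty 0
    have hxσ : x ≠ σ x := fun h' => by
      have := S.rel_unique (hσ x) ((S.diag _ _).2 h')
      revert this
      decide
    have mid : ∀ l : Fin 5, l ≠ 0 → l ≠ 4 → ∀ w, S.R l x w → w ≠ x ∧ w ≠ σ x := by
      refine fun l h0 h4 w hr => ⟨?_, ?_⟩
      · rintro rfl
        exact h0 (S.rel_unique hr (S.rel_zero_self _))
      · rintro rfl
        exact h4 (S.rel_unique hr (hσ _))
    have e : ∀ w, h x w * h w x =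
        s ^ 2 * (if w = x then 1 else 0) + s ^ 2 * (if w = σ x then 1 else 0) + (1 - κ x w) := by
      intro w
      rw [h_symm w x]
      rcases S.rel_cases x w with hr | hr | hr | hr | hr
      · have : x = w := (S.diag _ _).1 hr
        subst this
        rw [h_self, κ_self]
        simp [hxσ]
        ring
      · obtain ⟨n1, n2⟩ := mid 1 (by decide) (by decide) w hr
        rw [h_val _ _ _ hr, κ_val _ _ _ hr]
        simp [n1, n2]
      · obtain ⟨n1, n2⟩ := mid 2 (by decide) (by decide) w hr
        rw [h_val _ _ _ hr, κ_val _ _ _ hr]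
        simp [n1, n2]
      · obtain ⟨n1, n2⟩ := mid 3 (by decide) (by decide) w hr
        rw [h_val _ _ _ hr, κ_val _ _ _ hr]
        simp [n1, n2]
      · have hw := σ_unique x w hr
        rw [h_val _ _ _ hr, κ_val _ _ _ hr]
        simp [hw, hxσ.symm]
        ring
    have h1 := h_sum x x
    simp_rw [e] at h1
    rw [Finset.sum_add_distrib, Finset.sum_add_distrib, ← Finset.mul_sum, ← Finset.mul_sum,
      Finset.sum_sub_distrib, κ_sum, h_self] at h1
    simp [← hndef] at h1
    field_simp at h1
    linarith
  refine ⟨s, h, κ, σ, hs, sq_eq, h_val, κ_val, κ_congr, κ_sum, card_eq, fun x y => ?_, hσ, h_σ⟩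
  rw [h_sum, card_eq, ← sq_eq]
  field_simp

namespace IsUnbiasedFrame

variable [Fintype X] {S : AssocScheme X 4} {f d : ℕ} {s : ℝ} {h κ : X → X → ℝ} {σ : X → X}
  (F : S.IsUnbiasedFrame f d s h κ σ)

include F

theorem h_symm (x y : X) : h x y = h y x := by
  obtain ⟨l, hl, -⟩ := S.partition x y
  rw [F.h_val _ _ _ hl, F.h_val _ _ _ (S.symm _ _ _ hl)]

theorem κ_symm (x y : X) : κ x y = κ y x := by
  obtain ⟨l, hl, -⟩ := S.partition x y
  rw [F.κ_val _ _ _ hl, F.κ_val _ _ _ (S.symm _ _ _ hl)]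

theorem h_self (x : X) : h x x = s := F.h_val 0 x x (S.rel_zero_self x)

theorem κ_self (x : X) : κ x x = 1 := F.κ_val 0 x x (S.rel_zero_self x)

theorem rel_iff (l : Fin 5) (x y : X) :
    S.R l x y ↔ h x y = (![s, 1, 0, -1, -s] : Fin 5 → ℝ) l := by
  refine ⟨F.h_val l x y, fun hl => ?_⟩
  obtain ⟨k, hk, -⟩ := S.partition x y
  rwa [← injective_natural_values F.one_lt ((F.h_val _ _ _ hk).symm.trans hl)]

theorem κ_zero_or_one (x y : X) : κ x y = 0 ∨ κ x y = 1 := by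
  rcases S.rel_cases x y with hr | hr | hr | hr | hr <;> rw [F.κ_val _ _ _ hr] <;> simp

theorem κ_mul (x y w : X) : κ x w * κ w y = κ x y * κ x w := by
  rcases F.κ_zero_or_one x w with h1 | h1
  · simp [h1]
  · rw [h1, one_mul, mul_one, F.κ_congr x w h1 y]

theorem κ_σ (x y : X) : κ (σ x) y = κ x y :=
  (F.κ_congr x (σ x) (F.κ_val 4 _ _ (F.rel_σ x)) y).symm

theorem σ_σ (x : X) : σ (σ x) = x := by
  rw [← S.diag, F.rel_iff, F.h_σ, F.h_σ, F.h_self]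
  simp

theorem σ_involutive : Function.Involutive σ := F.σ_σ

end IsUnbiasedFrame

end AssocScheme

/-! ### Tightness of each class and sums over a subconstituent -/

namespace AssocScheme

theorem sum_subconstituent {X : Type*} [Fintype X] {D : ℕ} (S : AssocScheme X D)
    (j : Fin (D + 1)) (z : X) (p : X → Prop) [DecidablePred p] (hp : ∀ w, S.R j z w ↔ p w)
    (g : X → ℝ) : ∑ w : S.Subconstituent j z, g w.1 = ∑ w, if p w then g w else 0 := by
  rw [← Finset.sum_filter]
  exact (Finset.sum_subtype (p := fun w => S.R j z w) (F := (inferInstance :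
    Fintype (S.Subconstituent j z))) (Finset.univ.filter p) (by simp [hp]) g).symm

namespace IsUnbiasedFrame

variable {X : Type*} [Fintype X] {S : AssocScheme X 4} {f d : ℕ} {s : ℝ} {h κ : X → X → ℝ}
  {σ : X → X} (F : S.IsUnbiasedFrame f d s h κ σ)

include F

theorem eq_σ_iff (x y : X) : y = σ x ↔ S.R 4 x y := by
  refine ⟨fun h' => h' ▸ F.rel_σ x, fun h' => ?_⟩
  rw [eq_comm, ← S.diag, F.rel_iff, F.h_σ, F.h_val _ _ _ h']
  simp

theorem κ_mul_h [DecidableEq X] (x w : X) :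
    κ x w * h x w = s * (if w = x then 1 else 0) - s * (if w = σ x then 1 else 0) := by
  have e0 : w = x ↔ S.R 0 x w := by rw [S.diag, eq_comm]
  have e4 := F.eq_σ_iff x w
  have u : ∀ a b : Fin 5, a ≠ b → S.R a x w → ¬ S.R b x w := fun a b hab ha hb =>
    hab (S.rel_unique ha hb)
  rcases S.rel_cases x w with hr | hr | hr | hr | hr <;>
    rw [F.κ_val _ _ _ hr, F.h_val _ _ _ hr]
  · rw [if_pos (e0.2 hr), if_neg (mt e4.1 (u 0 4 (by decide) hr))]; simp
  · rw [if_neg (mt e0.1 (u 1 0 (by decide) hr)), if_neg (mt e4.1 (u 1 4 (by decide) hr))]; simp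
  · rw [if_neg (mt e0.1 (u 2 0 (by decide) hr)), if_neg (mt e4.1 (u 2 4 (by decide) hr))]; simp
  · rw [if_neg (mt e0.1 (u 3 0 (by decide) hr)), if_neg (mt e4.1 (u 3 4 (by decide) hr))]; simp
  · rw [if_neg (mt e0.1 (u 4 0 (by decide) hr)), if_pos (e4.2 hr)]; simp

theorem sum_κ_mul_of_same {c w : X} (hcw : κ c w = 1) (x : X) :
    ∑ u, κ c u * (h w u * h u x) = 2 * s * h w x := by
  classical
  have e : ∀ u, κ c u * (h w u * h u x) =
      s * (if u = w then h u x else 0) - s * (if u = σ w then h u x else 0) := fun u => by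
    rw [F.κ_congr c w hcw u, ← mul_assoc, F.κ_mul_h]
    split_ifs <;> ring
  simp_rw [e]
  rw [Finset.sum_sub_distrib, ← Finset.mul_sum, ← Finset.mul_sum]
  simp [F.h_σ]
  ring

/-- Parseval at $x$: if $x$ lies outside the class, all $2d = 2s^2$ inner products are $\pm 1$. -/
theorem sum_κ_mul_sq (c x : X) : ∑ u, κ c u * (h x u * h u x) = 2 * s * h x x := by
  rcases F.κ_zero_or_one c x with hcx | hcx
  · have e : ∀ u, κ c u * (h x u * h u x) = κ c u := fun u => by
      rcases F.κ_zero_or_one c u with hcu | hcu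
      · simp [hcu]
      · have hxu : κ x u = 0 := by rw [F.κ_symm, ← F.κ_congr c u hcu, hcx]
        rw [F.h_symm u x]
        rcases S.rel_cases x u with hr | hr | hr | hr | hr <;> rw [F.κ_val _ _ _ hr] at hxu <;>
          rw [F.h_val _ _ _ hr] <;> simp at hxu ⊢
    simp_rw [e]
    rw [F.κ_sum, F.h_self, ← F.sq_eq]
    ring
  · exact F.sum_κ_mul_of_same hcx x

/-- Every class of the frame is tight. -/
theorem sum_κ_mul (c x y : X) : ∑ u, κ c u * (h x u * h u y) = 2 * s * h x y := by
  -- The defect $v$ of tightness lies in the row space of $h$ and vanishes at $x$ and on the class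
  -- of $c$. Being a combination of the rows of $h$ at exactly those points, it is orthogonal to
  -- itself.
  obtain ⟨v, hv⟩ : ∃ v : X → ℝ, ∀ y, v y = 2 * s * h x y - ∑ u, κ c u * (h x u * h u y) :=
    ⟨_, fun _ => rfl⟩
  have v_self : v x = 0 := by rw [hv, F.sum_κ_mul_sq, sub_self]
  have v_class : ∀ w, κ c w * v w = 0 := by
    intro w
    rcases F.κ_zero_or_one c w with hcw | hcw
    · rw [hcw, zero_mul]
    · have h1 := F.sum_κ_mul_of_same hcw x
      have h2 : ∑ u, κ c u * (h x u * h u w) = 2 * s * h w x := by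
        rw [← h1]
        exact Finset.sum_congr rfl fun u _ => by rw [F.h_symm x u, F.h_symm u w]; ring
      rw [hv, h2, F.h_symm w x, sub_self, mul_zero]
  have v_mul : ∀ t, ∑ u, v u * h u t = 2 * f * s * v t := by
    intro t
    simp only [hv, sub_mul, Finset.sum_sub_distrib, Finset.sum_mul, mul_sub, Finset.mul_sum]
    congr 1
    · simp_rw [mul_assoc (2 * s), ← Finset.mul_sum]
      rw [F.h_sum]
      ring
    · rw [Finset.sum_comm]
      refine Finset.sum_congr rfl fun w _ => ?_
      have : ∀ u, κ c w * (h x w * h w u) * h u t = κ c w * h x w * (h w u * h u t) := fun u => by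
        ring
      simp_rw [this, ← Finset.mul_sum]
      rw [F.h_sum]
      ring
  have v_sq : ∑ u, v u * v u = 0 := by
    have e : ∀ u, v u * v u = 2 * s * (v u * h u x)
        - ∑ w, κ c w * h x w * (v u * h u w) := fun u => by
      nth_rw 2 [hv]
      rw [mul_sub, Finset.mul_sum, F.h_symm x u]
      congr 1
      · ring
      · refine Finset.sum_congr rfl fun w _ => ?_
        rw [F.h_symm w u]
        ring
    simp_rw [e]
    rw [Finset.sum_sub_distrib, ← Finset.mul_sum, v_mul, v_self, Finset.sum_comm]
    simp_rw [← Finset.mul_sum, v_mul]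
    have : ∀ w, κ c w * h x w * (2 * f * s * v w) = 0 := fun w => by
      linear_combination (h x w * (2 * f * s)) * v_class w
    simp [this]
  have := (Finset.sum_eq_zero_iff_of_nonneg fun w _ => mul_self_nonneg (v w)).1 v_sq y
    (Finset.mem_univ y)
  have hy : v y = 0 := mul_self_eq_zero.1 this
  linarith [hv y]

/-- A subconstituent meets every antipodal pair outside the class of its base point once. -/
theorem two_mul_sum_subconstituent {j : Fin 5} {z a : X} (ha : ∀ w, S.R j z w ↔ S.R 1 a w)
    (g : X → ℝ) (hg : ∀ w, g (σ w) = g w) :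
    2 * ∑ w : S.Subconstituent j z, g w.1 = ∑ w, g w - ∑ w, κ a w * g w := by
  classical
  rw [S.sum_subconstituent j z (fun w => S.R 1 a w) ha g]
  -- The antipodal map exchanges $R_1(a)$ and $R_3(a)$, which together fill the complement of the
  -- class of $a$.
  have e1 : ∑ w, (if S.R 1 a w then g w else 0) = ∑ w, if S.R 3 a w then g w else 0 := by
    rw [← Equiv.sum_comp (Function.Involutive.toPerm σ F.σ_involutive)]
    refine Finset.sum_congr rfl fun w _ => ?_
    have : S.R 1 a (σ w) ↔ S.R 3 a w := by
      rw [F.rel_iff, F.rel_iff, F.h_symm, F.h_σ, F.h_symm, neg_eq_iff_eq_neg]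
      simp
    simp [this, hg]
  rw [two_mul]
  nth_rw 2 [e1]
  rw [← Finset.sum_add_distrib, ← Finset.sum_sub_distrib]
  refine Finset.sum_congr rfl fun w _ => ?_
  have u : ∀ b c : Fin 5, b ≠ c → S.R b a w → ¬ S.R c a w := fun b c hbc hb hc =>
    hbc (S.rel_unique hb hc)
  rcases S.rel_cases a w with hr | hr | hr | hr | hr <;> rw [F.κ_val _ _ _ hr]
  · simp [u 0 1 (by decide) hr, u 0 3 (by decide) hr]
  · simp [hr, u 1 3 (by decide) hr]
  · simp [u 2 1 (by decide) hr, u 2 3 (by decide) hr]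
  · simp [hr, u 3 1 (by decide) hr]
  · simp [u 4 1 (by decide) hr, u 4 3 (by decide) hr]

section Subconstituent

variable {j : Fin 5} {z a : X} (ha : ∀ w, S.R j z w ↔ S.R 1 a w)

include ha

theorem h_base (y : S.Subconstituent j z) : h a y.1 = 1 := F.h_val 1 _ _ ((ha _).1 y.2)

theorem κ_base (y : S.Subconstituent j z) : κ a y.1 = 0 := F.κ_val 1 _ _ ((ha _).1 y.2)

theorem card_subconstituent :
    (Fintype.card (S.Subconstituent j z) : ℝ) = ((f : ℝ) - 1) * d := by
  have h1 := F.two_mul_sum_subconstituent ha (fun _ => 1) fun _ => rfl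
  simp only [mul_one, F.κ_sum, Finset.sum_const, Finset.card_univ, nsmul_eq_mul, F.card_eq] at h1
  linarith

theorem sum_κ_subconstituent (x : S.Subconstituent j z) :
    ∑ w : S.Subconstituent j z, κ x.1 w.1 = d := by
  have h1 := F.two_mul_sum_subconstituent ha (fun w => κ x.1 w) fun w => by
    rw [F.κ_symm, F.κ_σ, F.κ_symm]
  have h2 : ∀ w, κ a w * κ x.1 w = 0 := fun w => by
    rw [F.κ_symm x.1 w, F.κ_mul, F.κ_base ha, zero_mul]
  simp only [h2, F.κ_sum, Finset.sum_const_zero] at h1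
  linarith

theorem sum_h_mul_κ_subconstituent (x y : S.Subconstituent j z) :
    ∑ w : S.Subconstituent j z, h x.1 w.1 * κ w.1 y.1 = s := by
  -- The factor $h(w,a)$ equals $1$ on the subconstituent; it makes the summand even, so that
  -- tightness of the class of $y$ applies.
  have h1 := F.two_mul_sum_subconstituent ha (fun w => κ y.1 w * (h x.1 w * h w a)) fun w => by
    rw [F.κ_symm, F.κ_σ, F.κ_symm, F.h_σ, F.h_symm x.1, F.h_σ, F.h_symm x.1]
    ring
  have h2 : ∀ w, κ a w * (κ y.1 w * (h x.1 w * h w a)) = 0 := fun w => by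
    rw [← mul_assoc, F.κ_symm y.1 w, F.κ_mul, F.κ_base ha, zero_mul, zero_mul]
  rw [F.sum_κ_mul, F.h_symm x.1 a, F.h_base ha] at h1
  simp only [h2, Finset.sum_const_zero] at h1
  have h3 : ∀ w : S.Subconstituent j z,
      κ y.1 w.1 * (h x.1 w.1 * h w.1 a) = h x.1 w.1 * κ w.1 y.1 := fun w => by
    rw [F.h_symm w.1 a, F.h_base ha, F.κ_symm]
    ring
  simp only [h3] at h1
  linarith

theorem sum_h_mul_h_subconstituent (x y : S.Subconstituent j z) :
    ∑ w : S.Subconstituent j z, h x.1 w.1 * h w.1 y.1 = ((f : ℝ) - 1) * s * h x.1 y.1 := by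
  have h1 := F.two_mul_sum_subconstituent ha (fun w => h x.1 w * h w y.1) fun w => by
    rw [F.h_σ, F.h_symm x.1, F.h_σ, F.h_symm x.1]
    ring
  rw [F.sum_κ_mul, F.h_sum] at h1
  linarith

/-- Antipodal points have opposite inner products with $a$, whereas here both would be $1$. -/
theorem not_rel_four_subconstituent (x y : S.Subconstituent j z) : ¬ S.R 4 x.1 y.1 := by
  intro h4
  have h1 := F.h_base ha y
  rw [(F.eq_σ_iff _ _).2 h4, F.h_symm, F.h_σ, F.h_symm, F.h_base ha] at h1
  norm_num at h1

end Subconstituent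

end IsUnbiasedFrame

end AssocScheme

/-! ### Intersection numbers of a system of bases -/

namespace AssocScheme

/-- The relations of a three-class scheme are recorded by the inner products `H` of vectors from
`f - 1` orthogonal bases in dimension `d = s ^ 2`, with `K` the indicator of lying in
the same basis. -/
structure IsBasisSystem {Y : Type*} [Fintype Y] (R : Fin 4 → Y → Y → Prop) (f d : ℕ) (s : ℝ)
    (H K : Y → Y → ℝ) : Prop where
  one_lt : 1 < s
  sq_eq : s ^ 2 = d
  three_le : 3 ≤ f
  diag : ∀ x y, R 0 x y ↔ x = y
  partition : ∀ x y, ∃! i, R i x y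
  symm : ∀ i x y, R i x y → R i y x
  H_val : ∀ l x y, R l x y → H x y = (![s, 1, 0, -1] : Fin 4 → ℝ) l
  K_val : ∀ l x y, R l x y → K x y = (![1, 0, 1, 0] : Fin 4 → ℝ) l
  K_congr : ∀ x y, K x y = 1 → ∀ w, K x w = K y w
  card_eq : (Fintype.card Y : ℝ) = ((f : ℝ) - 1) * d
  sum_K : ∀ x, ∑ w, K x w = d
  sum_H_K : ∀ x y, ∑ w, H x w * K w y = s
  sum_H_H : ∀ x y, ∑ w, H x w * H w y = ((f : ℝ) - 1) * s * H x y

namespace IsBasisSystem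

/-- Coefficients of the adjacency matrices with respect to the all-ones matrix, `K`, `H` and the
identity. -/
noncomputable def coeff (s : ℝ) : Matrix (Fin 4) (Fin 4) ℝ :=
  !![0, 0, 0, 1; 1 / 2, -1 / 2, 1 / 2, -s / 2; 0, 1, 0, -1; 1 / 2, -1 / 2, -1 / 2, s / 2]

/-- The intersection number $p_{ij}^k$ as a real number, with `φ = f`. -/
noncomputable def pVal (φ s : ℝ) (i j k : Fin 4) : ℝ :=
  let a := coeff s i
  let b := coeff s j
  let K : ℝ := (![1, 0, 1, 0] : Fin 4 → ℝ) k
  let H : ℝ := (![s, 1, 0, -1] : Fin 4 → ℝ) k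
  let δ : ℝ := (![1, 0, 0, 0] : Fin 4 → ℝ) k
  a 0 * b 0 * ((φ - 1) * s ^ 2) + (a 0 * b 1 + a 1 * b 0) * s ^ 2
    + (a 0 * b 2 + a 2 * b 0) * ((φ - 1) * s) + a 1 * b 1 * (s ^ 2 * K)
    + (a 1 * b 2 + a 2 * b 1) * s + a 2 * b 2 * ((φ - 1) * s * H)
    + (a 0 * b 3 + a 3 * b 0) + (a 1 * b 3 + a 3 * b 1) * K + (a 2 * b 3 + a 3 * b 2) * H
    + a 3 * b 3 * δ

variable {Y : Type*} [Fintype Y] {R : Fin 4 → Y → Y → Prop} {f d : ℕ} {s : ℝ} {H K : Y → Y → ℝ}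
  (B : IsBasisSystem R f d s H K)

include B

theorem rel_unique {i j : Fin 4} {x y : Y} (hi : R i x y) (hj : R j x y) : i = j :=
  (B.partition x y).unique hi hj

theorem K_symm (x y : Y) : K x y = K y x := by
  obtain ⟨l, hl, -⟩ := B.partition x y
  rw [B.K_val _ _ _ hl, B.K_val _ _ _ (B.symm _ _ _ hl)]

theorem H_symm (x y : Y) : H x y = H y x := by
  obtain ⟨l, hl, -⟩ := B.partition x y
  rw [B.H_val _ _ _ hl, B.H_val _ _ _ (B.symm _ _ _ hl)]

theorem K_zero_or_one (x y : Y) : K x y = 0 ∨ K x y = 1 := by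
  obtain ⟨l, hl, -⟩ := B.partition x y
  rw [B.K_val _ _ _ hl]
  fin_cases l <;> simp

theorem K_self (x : Y) : K x x = 1 := B.K_val 0 x x ((B.diag x x).2 rfl)

theorem three_le_real : (3 : ℝ) ≤ f := by exact_mod_cast B.three_le

theorem d_pos : (0 : ℝ) < d := by
  have := B.one_lt
  rw [← B.sq_eq]
  positivity

theorem sum_K_K (x y : Y) : ∑ w, K x w * K w y = d * K x y := by
  have : ∀ w, K x w * K w y = K x y * K x w := fun w => by
    rcases B.K_zero_or_one x w with h1 | h1
    · simp [h1]
    · rw [h1, one_mul, mul_one, B.K_congr x w h1 y]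
  simp_rw [this, ← Finset.mul_sum, B.sum_K, mul_comm]

theorem sum_K_H (x y : Y) : ∑ w, K x w * H w y = s := by
  rw [← B.sum_H_K y x]
  exact Finset.sum_congr rfl fun w _ => by rw [B.K_symm, B.H_symm, mul_comm]

/-- Row sums of $HK = sJ$, divided by the row sum $d$ of $K$. -/
theorem sum_H (x : Y) : ∑ w, H x w = ((f : ℝ) - 1) * s := by
  refine mul_right_cancel₀ B.d_pos.ne' ?_
  have h1 : ∑ y, ∑ w, H x w * K w y = ∑ _y : Y, s := Finset.sum_congr rfl fun y _ => B.sum_H_K x y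
  rw [Finset.sum_comm] at h1
  simp_rw [← Finset.mul_sum, B.sum_K] at h1
  rw [← Finset.sum_mul] at h1
  rw [h1]
  simp [B.card_eq]
  ring

theorem indicator_eq [DecidableEq Y] [∀ i x y, Decidable (R i x y)] (i : Fin 4) (x y : Y) :
    (if R i x y then (1 : ℝ) else 0) = coeff s i 0 + coeff s i 1 * K x y + coeff s i 2 * H x y
      + coeff s i 3 * (if x = y then 1 else 0) := by
  obtain ⟨l, hl, -⟩ := B.partition x y
  have hi : R i x y ↔ i = l := ⟨fun h => B.rel_unique h hl, fun h => h ▸ hl⟩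
  have h0 : x = y ↔ l = 0 := by
    rw [← B.diag]
    exact ⟨fun h => B.rel_unique hl h, fun h => h ▸ hl⟩
  rw [B.H_val _ _ _ hl, B.K_val _ _ _ hl, if_congr hi rfl rfl, if_congr h0 rfl rfl]
  fin_cases i <;> fin_cases l <;> simp [coeff] <;> ring

theorem ncard_eq (i j k : Fin 4) (x y : Y) (hk : R k x y) :
    ({w | R i x w ∧ R j w y}.ncard : ℝ) = pVal f s i j k := by
  classical
  rw [Set.ncard_eq_sum_indicator (fun w => R i x w ∧ R j w y)
    (fun w => (if R i x w then (1 : ℝ) else 0) * (if R j w y then 1 else 0))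
    (fun w hw => by simp [hw.1, hw.2]) (fun w hw => by
      by_cases h1 : R i x w
      · have : ¬ R j w y := fun h2 => hw ⟨h1, h2⟩
        simp [this]
      · simp [h1])]
  simp_rw [B.indicator_eq]
  set a := coeff s i with ha
  set b := coeff s j with hb
  have e : ∀ w, (a 0 + a 1 * K x w + a 2 * H x w + a 3 * (if x = w then 1 else 0)) *
      (b 0 + b 1 * K w y + b 2 * H w y + b 3 * (if w = y then 1 else 0)) =
      a 0 * b 0 * 1 + a 0 * b 1 * K y w + a 1 * b 0 * K x w + a 0 * b 2 * H y w + a 2 * b 0 * H x w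
      + a 1 * b 1 * (K x w * K w y) + a 1 * b 2 * (K x w * H w y) + a 2 * b 1 * (H x w * K w y)
      + a 2 * b 2 * (H x w * H w y)
      + (if w = y then b 3 * (a 0 + a 1 * K x w + a 2 * H x w + a 3 * (if x = w then 1 else 0))
        else 0)
      + (if x = w then a 3 * (b 0 + b 1 * K w y + b 2 * H w y) else 0) := fun w => by
    rw [B.K_symm y w, B.H_symm y w]
    split_ifs <;> ring
  simp_rw [e]
  simp only [Finset.sum_add_distrib, ← Finset.mul_sum, B.sum_K, B.sum_H, B.sum_K_K, B.sum_K_H,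
    B.sum_H_K, B.sum_H_H, Finset.sum_ite_eq, Finset.sum_ite_eq', Finset.mem_univ, if_true,
    Finset.sum_const, Finset.card_univ, nsmul_eq_mul, mul_one, B.card_eq]
  have hδ : (if x = y then (1 : ℝ) else 0) = (![1, 0, 0, 0] : Fin 4 → ℝ) k := by
    have h0 : x = y ↔ k = 0 := by
      rw [← B.diag]
      exact ⟨fun h => B.rel_unique hk h, fun h => h ▸ hk⟩
    rw [if_congr h0 rfl rfl]
    fin_cases k <;> simp
  rw [hδ, B.H_val _ _ _ hk, B.K_val _ _ _ hk, ← B.sq_eq, pVal, ← ha, ← hb]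
  ring

theorem exists_rel_of_pVal_pos (k : Fin 4) (hk : 0 < pVal f s k k 0) (x : Y) : ∃ y, R k x y := by
  have h1 := B.ncard_eq k k 0 x x ((B.diag x x).2 rfl)
  rw [← h1] at hk
  have h2 : 0 < {w | R k x w ∧ R k w x}.ncard := by exact_mod_cast hk
  obtain ⟨y, hy, -⟩ := (Set.ncard_pos (Set.toFinite _)).1 h2
  exact ⟨y, hy⟩

/-- These are the valencies; $f > 2$ and $s > 1$ make all four relations non-empty. -/
theorem pVal_valency_pos (k : Fin 4) : 0 < pVal f s k k 0 := by
  have h1 := B.one_lt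
  have h3 := B.three_le_real
  have hs : 0 < s * (s - 1) := by nlinarith
  fin_cases k
  · simp [pVal, coeff]
  · have : pVal f s 1 1 0 = ((f : ℝ) - 2) * (s * (s + 1)) / 2 := by
      simp [pVal, coeff]; ring
    change 0 < pVal f s 1 1 0
    rw [this]
    exact div_pos (mul_pos (by linarith) (by nlinarith)) two_pos
  · have : pVal f s 2 2 0 = s ^ 2 - 1 := by
      simp [pVal, coeff]; ring
    change 0 < pVal f s 2 2 0
    rw [this]
    nlinarith
  · have : pVal f s 3 3 0 = ((f : ℝ) - 2) * (s * (s - 1)) / 2 := by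
      simp [pVal, coeff]; ring
    change 0 < pVal f s 3 3 0
    rw [this]
    exact div_pos (mul_pos (by linarith) hs) two_pos

theorem nonempty_rel (k : Fin 4) : ∃ x y, R k x y := by
  have hpos : (0 : ℝ) < Fintype.card Y := by
    rw [B.card_eq]
    exact mul_pos (by linarith [B.three_le_real]) B.d_pos
  obtain ⟨x⟩ : Nonempty Y := Fintype.card_pos_iff.1 (by exact_mod_cast hpos)
  exact ⟨x, B.exists_rel_of_pVal_pos k (B.pVal_valency_pos k) x⟩

omit B in
/-- The three-class scheme of a system of bases. -/
noncomputable def scheme (B : IsBasisSystem R f d s H K) : AssocScheme Y 3 where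
  R := R
  diag := B.diag
  partition := B.partition
  nonempty := B.nonempty_rel
  symm := B.symm
  -- The real value is a cardinality whenever $R_k$ holds, so the floor loses nothing.
  p i j k := ⌊pVal f s i j k⌋₊
  regular i j k x y hk := by rw [← B.ncard_eq i j k x y hk, Nat.floor_natCast]

theorem intersectionMatrix_apply (i j k : Fin 4) :
    B.scheme.intersectionMatrix i j k = pVal f s i j k := by
  obtain ⟨x, y, hk⟩ := B.nonempty_rel k
  rw [← B.ncard_eq i j k x y hk]
  exact congrArg Nat.cast (B.scheme.regular i j k x y hk).symm

theorem sqrt_eq : √(d : ℝ) = s := by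
  rw [← B.sq_eq]
  exact Real.sqrt_sq (by linarith [B.one_lt])

theorem intersectionMatrix_one : B.scheme.intersectionMatrix 1 =
    !![0, 1, 0, 0;
       ((f : ℝ) - 2) * (d + √d) / 2, ((f : ℝ) - 3) * (d + 3 * √d) / 4,
         ((f : ℝ) - 2) * (d + 2 * √d) / 4, ((f : ℝ) - 3) * (d + √d) / 4;
       0, ((d : ℝ) + √d - 2) / 2, 0, ((d : ℝ) + √d) / 2;
       0, ((f : ℝ) - 3) * (d - √d) / 4, ((f : ℝ) - 2) * d / 4,
         ((f : ℝ) - 3) * (d + √d) / 4] := by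
  rw [B.sqrt_eq, ← B.sq_eq]
  ext j k
  refine (B.intersectionMatrix_apply 1 j k).trans ?_
  fin_cases j <;> fin_cases k <;> simp [pVal, coeff] <;> ring

theorem intersectionMatrix_two : B.scheme.intersectionMatrix 2 =
    !![0, 0, 1, 0;
       0, ((d : ℝ) + √d - 2) / 2, 0, ((d : ℝ) + √d) / 2;
       (d : ℝ) - 1, 0, (d : ℝ) - 2, 0;
       0, ((d : ℝ) - √d) / 2, 0, ((d : ℝ) - √d - 2) / 2] := by
  rw [B.sqrt_eq, ← B.sq_eq]
  ext j k
  refine (B.intersectionMatrix_apply 2 j k).trans ?_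
  fin_cases j <;> fin_cases k <;> simp [pVal, coeff] <;> ring

theorem intersectionMatrix_three : B.scheme.intersectionMatrix 3 =
    !![0, 0, 0, 1;
       0, ((f : ℝ) - 3) * (d - √d) / 4, ((f : ℝ) - 2) * d / 4,
         ((f : ℝ) - 3) * (d + √d) / 4;
       0, ((d : ℝ) - √d) / 2, 0, ((d : ℝ) - √d - 2) / 2;
       ((f : ℝ) - 2) * (d - √d) / 2, ((f : ℝ) - 3) * (d - √d) / 4,
         ((f : ℝ) - 2) * (d - 2 * √d) / 4, ((f : ℝ) - 3) * (d - 3 * √d) / 4] := by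
  rw [B.sqrt_eq, ← B.sq_eq]
  ext j k
  refine (B.intersectionMatrix_apply 3 j k).trans ?_
  fin_cases j <;> fin_cases k <;> simp [pVal, coeff] <;> ring

end IsBasisSystem

end AssocScheme

/-! ### Idempotents, eigenmatrix and Krein matrix of a system of bases -/

namespace AssocScheme

theorem eq_sum_smul_A_of_apply {X : Type*} {D : ℕ} (S : AssocScheme X D) {M : Matrix X X ℝ}
    (c : Fin (D + 1) → ℝ) (h : ∀ l x y, S.R l x y → M x y = c l) : M = ∑ i, c i • S.A i := by
  ext x y
  obtain ⟨l, hl, -⟩ := S.partition x y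
  rw [h l x y hl, S.sum_smul_A_apply c hl]

namespace IsBasisSystem

/-- The second eigenmatrix of the scheme of a system of bases, with `φ = f`. -/
noncomputable def eigenmatrix (φ s : ℝ) : Matrix (Fin 4) (Fin 4) ℝ :=
  !![1, s ^ 2 - 1, (φ - 2) * (s ^ 2 - 1), φ - 2;
     1, s - 1, -s + 1, -1;
     1, -1, -φ + 2, φ - 2;
     1, -s - 1, s + 1, -1]

variable {Y : Type*} [Fintype Y] {R : Fin 4 → Y → Y → Prop} {f d : ℕ} {s : ℝ} {H K : Y → Y → ℝ}

open Classical in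
/-- The primitive idempotents of the scheme of a system of bases. -/
noncomputable def idempotent (f d : ℕ) (s : ℝ) (H K : Y → Y → ℝ) : Fin 4 → Matrix Y Y ℝ :=
  let Z : Matrix Y Y ℝ := Matrix.of fun _ _ => (Fintype.card Y : ℝ)⁻¹
  let U : Matrix Y Y ℝ := Matrix.of fun x y => (d : ℝ)⁻¹ * K x y
  let V : Matrix Y Y ℝ := Matrix.of fun x y => (((f : ℝ) - 1) * s)⁻¹ * H x y
  ![Z, V - Z, 1 - U - V + Z, U - Z]

theorem idempotent_apply (B : IsBasisSystem R f d s H K) (j l : Fin 4) (x y : Y) (hl : R l x y) :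
    idempotent f d s H K j x y = eigenmatrix f s l j / Fintype.card Y := by
  classical
  have h3 := B.three_le_real
  have h1 : (f : ℝ) - 1 ≠ 0 := by linarith
  have hs : s ≠ 0 := by linarith [B.one_lt]
  have h0 : x = y ↔ l = 0 := by
    rw [← B.diag]
    exact ⟨fun h => B.rel_unique hl h, fun h => h ▸ hl⟩
  have hδ : (1 : Matrix Y Y ℝ) x y = if l = 0 then 1 else 0 := by
    rw [Matrix.one_apply, if_congr h0 rfl rfl]
  rw [B.card_eq, ← B.sq_eq]
  fin_cases j <;>
    simp [idempotent, B.H_val _ _ _ hl, B.K_val _ _ _ hl, B.card_eq, ← B.sq_eq, hδ] <;>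
    fin_cases l <;> simp [eigenmatrix] <;> field_simp <;> ring

theorem idempotent_mul (B : IsBasisSystem R f d s H K) (i j : Fin 4) :
    idempotent f d s H K i * idempotent f d s H K j =
      if i = j then idempotent f d s H K i else 0 := by
  classical
  have h3 := B.three_le_real
  have h1 : (f : ℝ) - 1 ≠ 0 := by linarith
  have hs : s ≠ 0 := by linarith [B.one_lt]
  have hd := B.d_pos.ne'
  have hn : (Fintype.card Y : ℝ) ≠ 0 := by
    rw [B.card_eq]
    exact mul_ne_zero h1 hd
  set Z : Matrix Y Y ℝ := Matrix.of fun _ _ => (Fintype.card Y : ℝ)⁻¹ with hZ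
  set U : Matrix Y Y ℝ := Matrix.of fun x y => (d : ℝ)⁻¹ * K x y with hU
  set V : Matrix Y Y ℝ := Matrix.of fun x y => (((f : ℝ) - 1) * s)⁻¹ * H x y with hV
  have hE : idempotent f d s H K = ![Z, V - Z, 1 - U - V + Z, U - Z] := rfl
  have key : ∀ (a b : ℝ) (P Q : Y → Y → ℝ) (x y : Y),
      ∑ w, a * P x w * (b * Q w y) = a * b * ∑ w, P x w * Q w y := fun a b P Q x y => by
    rw [Finset.mul_sum]
    exact Finset.sum_congr rfl fun w _ => by ring
  have hZZ : Z * Z = Z := by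
    ext x y
    simp [Matrix.mul_apply, hZ, hn]
  have hUU : U * U = U := by
    ext x y
    simp only [Matrix.mul_apply, hU, Matrix.of_apply]
    rw [key, B.sum_K_K]
    field_simp
  have hVV : V * V = V := by
    ext x y
    simp only [Matrix.mul_apply, hV, Matrix.of_apply]
    rw [key, B.sum_H_H]
    field_simp
  have hUV : U * V = Z := by
    ext x y
    simp only [Matrix.mul_apply, hU, hV, hZ, Matrix.of_apply]
    rw [key, B.sum_K_H, B.card_eq]
    field_simp
  have hVU : V * U = Z := by
    ext x y
    simp only [Matrix.mul_apply, hU, hV, hZ, Matrix.of_apply]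
    rw [key, B.sum_H_K, B.card_eq]
    field_simp
  have hUZ : U * Z = Z := by rw [← hUV, ← mul_assoc, hUU]
  have hZU : Z * U = Z := by rw [← hVU, mul_assoc, hUU]
  have hVZ : V * Z = Z := by rw [← hVU, ← mul_assoc, hVV]
  have hZV : Z * V = Z := by rw [← hUV, mul_assoc, hVV]
  rw [hE]
  fin_cases i <;> fin_cases j <;>
    simp [mul_sub, sub_mul, mul_add, add_mul, hZZ, hUU, hVV, hUV, hVU, hUZ, hZU, hVZ, hZV]

theorem eigenmatrix_zero_ne_zero (B : IsBasisSystem R f d s H K) (j : Fin 4) :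
    eigenmatrix f s 0 j ≠ 0 := by
  have h1 := B.one_lt
  have h3 := B.three_le_real
  have h2 : (f : ℝ) - 2 ≠ 0 := by linarith
  have hs : s ^ 2 - 1 ≠ 0 := by nlinarith
  fin_cases j <;> simp [eigenmatrix, h2, hs]

theorem card_pos (B : IsBasisSystem R f d s H K) : (0 : ℝ) < Fintype.card Y := B.scheme.card_pos

/-- The ordering of the primitive idempotents for which the scheme is `Q`-polynomial. -/
noncomputable def idempotents (B : IsBasisSystem R f d s H K) : B.scheme.Idempotents where
  E := idempotent f d s H K
  mem j := by
    rw [B.scheme.eq_sum_smul_A_of_apply _ fun l x y hl => B.idempotent_apply j l x y hl]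
    exact Submodule.sum_mem _ fun i _ => Submodule.smul_mem _ _ (Submodule.subset_span ⟨i, rfl⟩)
  zero := rfl
  ne_zero j h := by
    obtain ⟨x, -⟩ := B.nonempty_rel 0
    have h1 := B.idempotent_apply j 0 x x ((B.diag x x).2 rfl)
    rw [h, Matrix.zero_apply, eq_comm, div_eq_zero_iff] at h1
    exact h1.elim (B.eigenmatrix_zero_ne_zero j) B.card_pos.ne'
  idem j := by rw [B.idempotent_mul, if_pos rfl]
  orthogonal i j hij := by rw [B.idempotent_mul, if_neg hij]

theorem Q_eq (B : IsBasisSystem R f d s H K) : B.idempotents.Q = eigenmatrix f s := by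
  ext l j
  refine B.idempotents.Q_unique (c := fun l => eigenmatrix f s l j)
    (B.scheme.eq_sum_smul_A_of_apply _ fun l x y hl => ?_) l
  rw [Matrix.smul_apply, smul_eq_mul]
  refine (congrArg _ (B.idempotent_apply j l x y hl)).trans ?_
  exact mul_div_cancel₀ _ B.card_pos.ne'

theorem kreinMatrix_one (B : IsBasisSystem R f d s H K) : B.idempotents.kreinMatrix 1 =
    !![0, 1, 0, 0;
       (d : ℝ) - 1, (d : ℝ) / ((f : ℝ) - 1) - 2, (d : ℝ) / ((f : ℝ) - 1), 0;
       0, ((f : ℝ) - 2) * d / ((f : ℝ) - 1), ((f : ℝ) - 2) * d / ((f : ℝ) - 1) - 2, (d : ℝ) - 1;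
       0, 0, 1, 0] := by
  have h1 : (f : ℝ) - 1 ≠ 0 := by linarith [B.three_le_real]
  rw [← B.sq_eq]
  ext j k
  refine B.idempotents.q_unique (c := fun k => !![0, 1, 0, 0;
       s ^ 2 - 1, s ^ 2 / ((f : ℝ) - 1) - 2, s ^ 2 / ((f : ℝ) - 1), 0;
       0, ((f : ℝ) - 2) * s ^ 2 / ((f : ℝ) - 1), ((f : ℝ) - 2) * s ^ 2 / ((f : ℝ) - 1) - 2,
         s ^ 2 - 1;
       0, 0, 1, 0] j k) (fun l => ?_) k
  rw [B.Q_eq]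
  refine Eq.trans ?_ (Fin.sum_univ_four _).symm
  fin_cases j <;> fin_cases l <;> simp [eigenmatrix] <;> field_simp <;> ring

theorem isQPolynomial (B : IsBasisSystem R f d s H K) : B.idempotents.IsQPolynomial := by
  have hs1 := B.one_lt
  have h1 : (f : ℝ) - 1 ≠ 0 := by linarith [B.three_le_real]
  have hs : s ≠ 0 := by linarith
  have hs2 : s ^ 2 - 1 ≠ 0 := by nlinarith
  -- The values $Q_{l1} + 1$ are $s^2, s, 0, -s$, so the polynomials are written in $t = X + 1$.
  have deg : ∀ p : Polynomial ℝ, (p.comp (Polynomial.X + Polynomial.C 1)).natDegree =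
      p.natDegree := fun p => by
    rw [Polynomial.natDegree_comp, Polynomial.natDegree_X_add_C, mul_one]
  intro i
  rw [B.Q_eq]
  set a : ℝ := ((f : ℝ) - 1) / s ^ 2 with ha
  have ha0 : a ≠ 0 := div_ne_zero h1 (pow_ne_zero 2 hs)
  fin_cases i
  · refine ⟨1, by simp, fun l => ?_⟩
    fin_cases l <;> simp [eigenmatrix]
  · exact ⟨Polynomial.X, by simp, fun l => by simp⟩
  -- This is $a(t^2 - s^2) - t + 1$, which is $1 - t$ at $t = \pm s$.
  · refine ⟨(Polynomial.C a * Polynomial.X ^ 2 + Polynomial.C (-1) * Polynomial.X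
      + Polynomial.C (1 - a * s ^ 2)).comp (Polynomial.X + Polynomial.C 1), ?_, fun l => ?_⟩
    · rw [deg, Polynomial.natDegree_quadratic ha0]
    · fin_cases l <;> simp [eigenmatrix, ha] <;> field_simp <;> ring
  -- This is $a(t^2 - s^2)\bigl(t/(s^2 - 1) - 1\bigr) - 1$, which is $-1$ at $t = \pm s$ and $f - 2$
  -- at $t = 0$ and $t = s^2$.
  · refine ⟨(Polynomial.C (a / (s ^ 2 - 1)) * Polynomial.X ^ 3 + Polynomial.C (-a) * Polynomial.X ^ 2
      + Polynomial.C (-(a / (s ^ 2 - 1) * s ^ 2)) * Polynomial.X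
      + Polynomial.C (a * s ^ 2 - 1)).comp (Polynomial.X + Polynomial.C 1), ?_, fun l => ?_⟩
    · rw [deg, Polynomial.natDegree_cubic (div_ne_zero ha0 hs2)]
    · fin_cases l <;> simp [eigenmatrix, ha] <;> field_simp <;> ring

theorem isQAntipodal (B : IsBasisSystem R f d s H K) : B.idempotents.IsQAntipodal := by
  have hk : ∀ j k : Fin 4, B.idempotents.q 1 j k = B.idempotents.kreinMatrix 1 j k :=
    fun _ _ => rfl
  intro i hi
  fin_cases i
  · change B.idempotents.q 1 1 0 = B.idempotents.q 1 2 3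
    rw [hk, hk, B.kreinMatrix_one]
    simp
  -- The index $1 = \lfloor 3/2 \rfloor$ is exempt.
  · simp at hi
  · change B.idempotents.q 1 3 2 = B.idempotents.q 1 0 1
    rw [hk, hk, B.kreinMatrix_one]
    simp

theorem antipodalSetoid_iff (B : IsBasisSystem R f d s H K) (x y : Y) :
    B.idempotents.antipodalSetoid x y ↔ K y x = 1 := by
  have hd := B.d_pos.ne'
  have hE : ∀ x w, B.idempotents.E (Fin.last 3) x w = (d : ℝ)⁻¹ * K x w - (Fintype.card Y : ℝ)⁻¹ :=
    fun _ _ => rfl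
  constructor
  · intro h
    have h1 := congrFun h x
    simp only [hE] at h1
    rw [← B.K_self x]
    have h2 : (d : ℝ)⁻¹ * K x x = (d : ℝ)⁻¹ * K y x := by linarith
    exact (mul_left_cancel₀ (inv_ne_zero hd) h2).symm
  · intro h
    refine funext fun w => ?_
    simp only [hE, B.K_congr y x h w]

theorem hasAntipodalClasses (B : IsBasisSystem R f d s H K) :
    B.idempotents.HasAntipodalClasses (f - 1) d := by
  have hcl : ∀ c ∈ B.idempotents.antipodalSetoid.classes, c.ncard = d := by
    rintro _ ⟨x, rfl⟩
    have : ({w | B.idempotents.antipodalSetoid w x}.ncard : ℝ) = d := by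
      rw [← B.sum_K x]
      exact Set.ncard_eq_sum_indicator _ _ (fun w hw => (B.antipodalSetoid_iff w x).1 hw)
        fun w hw => (B.K_zero_or_one x w).resolve_right fun h => hw ((B.antipodalSetoid_iff w x).2 h)
    exact_mod_cast this
  refine ⟨?_, hcl⟩
  have h1 := B.idempotents.antipodalSetoid.ncard_classes_mul hcl
  have h2 : Fintype.card Y = (f - 1) * d := by
    have h3 := B.card_eq
    rw [← Nat.cast_pred (by linarith [B.three_le])] at h3
    exact_mod_cast h3
  have hd : 0 < d := by exact_mod_cast B.d_pos
  exact Nat.eq_of_mul_eq_mul_right hd (h1.trans h2)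

end IsBasisSystem

/-! ### Subconstituents as systems of bases, and the conclusion -/

theorem IsUnbiasedFrame.isBasisSystem {X : Type*} [Fintype X] {S : AssocScheme X 4} {f d : ℕ}
    {s : ℝ} {h κ : X → X → ℝ} {σ : X → X} (F : S.IsUnbiasedFrame f d s h κ σ) (hf : 3 ≤ f)
    {j : Fin 5} {z a : X} (ha : ∀ w, S.R j z w ↔ S.R 1 a w) :
    IsBasisSystem (Y := S.Subconstituent j z) (fun i x y => S.R i.castSucc x.1 y.1) f d s
      (fun x y => h x.1 y.1) (fun x y => κ x.1 y.1) where
  one_lt := F.one_lt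
  sq_eq := F.sq_eq
  three_le := hf
  diag x y := (S.diag x.1 y.1).trans Subtype.ext_iff.symm
  partition x y := by
    obtain ⟨l, hl, huniq⟩ := S.partition x.1 y.1
    have hl4 : l ≠ 4 := by
      rintro rfl
      exact F.not_rel_four_subconstituent ha x y hl
    refine ⟨l.castPred hl4, ?_, fun i hi => ?_⟩
    · simpa using hl
    · have := huniq _ hi
      exact Fin.castSucc_injective _ (by simpa using this)
  symm i x y := S.symm _ _ _
  H_val l x y hl := by
    rw [F.h_val _ _ _ hl]
    fin_cases l <;> rfl
  K_val l x y hl := by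
    rw [F.κ_val _ _ _ hl]
    fin_cases l <;> rfl
  K_congr x y hxy w := F.κ_congr _ _ hxy _
  card_eq := F.card_subconstituent ha
  sum_K := F.sum_κ_subconstituent ha
  sum_H_K := F.sum_h_mul_κ_subconstituent ha
  sum_H_H := F.sum_h_mul_h_subconstituent ha

/-- For $j = 3$ the base point is $\sigma z$, because the antipodal map negates inner products. -/
theorem IsUnbiasedFrame.exists_base {X : Type*} [Fintype X] {S : AssocScheme X 4} {f d : ℕ}
    {s : ℝ} {h κ : X → X → ℝ} {σ : X → X} (F : S.IsUnbiasedFrame f d s h κ σ)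
    {j : Fin 5} (hj : j = 1 ∨ j = 3) (z : X) : ∃ a, ∀ w, S.R j z w ↔ S.R 1 a w := by
  rcases hj with rfl | rfl
  · exact ⟨z, fun _ => Iff.rfl⟩
  · refine ⟨σ z, fun w => ?_⟩
    rw [F.rel_iff, F.rel_iff, F.h_σ, neg_eq_iff_eq_neg]
    simp

end AssocScheme

theorem lemma4p1 {X : Type*} [Fintype X] (S : AssocScheme X 4) (I : S.Idempotents)
    (hpoly : I.IsQPolynomial) (hanti : I.IsQAntipodal) (hbip : I.IsQBipartite)
    -- the relations are numbered in the natural order (decreasing inner products under `E 1`)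
    (hnat : ∀ i j : Fin 5, i < j → I.Q j 1 < I.Q i 1)
    (f d : ℕ) (hclasses : I.HasAntipodalClasses f (2 * d)) (hf : 3 ≤ f)
    (z : X) (j : Fin 5) (hj : j = 1 ∨ j = 3) :
    ∃ T : AssocScheme (S.Subconstituent j z) 3,
      (∀ (i : Fin 4) (x y : S.Subconstituent j z), T.R i x y ↔ S.R i.castSucc x.1 y.1) ∧
      ∃ K : T.Idempotents,
        K.IsQPolynomial ∧ K.IsQAntipodal ∧ K.HasAntipodalClasses (f - 1) d ∧
        K.aStar 1 = (d : ℝ) / ((f : ℝ) - 1) - 2 ∧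
        T.intersectionMatrix 1 =
          !![0, 1, 0, 0;
             ((f : ℝ) - 2) * (d + √d) / 2, ((f : ℝ) - 3) * (d + 3 * √d) / 4,
               ((f : ℝ) - 2) * (d + 2 * √d) / 4, ((f : ℝ) - 3) * (d + √d) / 4;
             0, ((d : ℝ) + √d - 2) / 2, 0, ((d : ℝ) + √d) / 2;
             0, ((f : ℝ) - 3) * (d - √d) / 4, ((f : ℝ) - 2) * d / 4,
               ((f : ℝ) - 3) * (d + √d) / 4] ∧
        T.intersectionMatrix 2 =
          !![0, 0, 1, 0;
             0, ((d : ℝ) + √d - 2) / 2, 0, ((d : ℝ) + √d) / 2;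
             (d : ℝ) - 1, 0, (d : ℝ) - 2, 0;
             0, ((d : ℝ) - √d) / 2, 0, ((d : ℝ) - √d - 2) / 2] ∧
        T.intersectionMatrix 3 =
          !![0, 0, 0, 1;
             0, ((f : ℝ) - 3) * (d - √d) / 4, ((f : ℝ) - 2) * d / 4,
               ((f : ℝ) - 3) * (d + √d) / 4;
             0, ((d : ℝ) - √d) / 2, 0, ((d : ℝ) - √d - 2) / 2;
             ((f : ℝ) - 2) * (d - √d) / 2, ((f : ℝ) - 3) * (d - √d) / 4,
               ((f : ℝ) - 2) * (d - 2 * √d) / 4, ((f : ℝ) - 3) * (d - 3 * √d) / 4] ∧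
        K.Q =
          !![1, (d : ℝ) - 1, ((f : ℝ) - 2) * (d - 1), (f : ℝ) - 2;
             1, √d - 1, -√d + 1, -1;
             1, -1, -(f : ℝ) + 2, (f : ℝ) - 2;
             1, -√d - 1, √d + 1, -1] ∧
        K.kreinMatrix 1 =
          !![0, 1, 0, 0;
             (d : ℝ) - 1, (d : ℝ) / ((f : ℝ) - 1) - 2, (d : ℝ) / ((f : ℝ) - 1), 0;
             0, ((f : ℝ) - 2) * d / ((f : ℝ) - 1), ((f : ℝ) - 2) * d / ((f : ℝ) - 1) - 2,
               (d : ℝ) - 1;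
             0, 0, 1, 0] := by
  obtain ⟨s, h, κ, σ, F⟩ := AssocScheme.Idempotents.exists_isUnbiasedFrame hpoly hanti hbip hnat
    hclasses
  obtain ⟨a, ha⟩ := F.exists_base hj z
  have B := F.isBasisSystem hf ha
  refine ⟨B.scheme, fun i x y => Iff.rfl, B.idempotents, B.isQPolynomial, B.isQAntipodal,
    B.hasAntipodalClasses, ?_, B.intersectionMatrix_one, B.intersectionMatrix_two,
    B.intersectionMatrix_three, ?_, B.kreinMatrix_one⟩
  · exact congrFun (congrFun B.kreinMatrix_one 1) 1
  · rw [B.Q_eq, B.sqrt_eq, ← B.sq_eq]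
    rfl
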